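/- Conventions. Let $\omega$ be a free ultrafilter on $\mathbb{N}$. For a unital C*-algebra $A$ let $A^\omega=\ell^\infty(\mathbb{N},A)/\{(a_k):\lim_{k\to\omega}\|a_k\|=0\}$, regard $A\subset A^\omega$ as constant sequences, and put $A_\omega=A^\omega\cap A'$. An action $\alpha\colon G\to\mathrm{Aut}(A)$ induces an action on $A^\omega$ and on $A_\omega$, also denoted by $\alpha$. For positive $a,b\in A$ write $a\precsim b$ if $v_kbv_k^*\to a$ for some sequence $(v_k)$ in $A$. For $f\in(A^\omega)_+$ and $a\in A_+$ write $f\precsim_{\mathrm{p.w.}}a$ if $f$ has a bounded representative $(f_k)$ with every $f_k$ positive and $f_k\precsim a$. For a finite subset $K$ of a group $G$ and $\varepsilon>0$, a nonempty finite set $T\subset G$ is $(K,\varepsilon)$-invariant if $|T\cap\bigcap_{g\in K}gT|\ge(1-\varepsilon)|T|$; a discrete group $G$ is amenable if such a $T$ exists for all $K$ and $\varepsilon$. An action $\alpha$ of $G$ on a simple unital C*-algebra $A$ has the weak tracial Rokhlin property if for every finite $K\subset G$, every $\varepsilon>0$ and every nonzero $z\in A_+$ there are $n\geq 1$, $(K,\varepsilon)$-invariant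 finite sets $T_1,\dots,T_n\subset G$ and positive contractions $e_1,\dots,e_n\in A_\omega$ such that (1) $\alpha_g(e_i)\alpha_h(e_j)=0$ whenever $g\in T_i$, $h\in T_j$ and $g\ne h$ or $i\ne j$; (2) $1-\sum_{i=1}^n\sum_{g\in T_i}\alpha_g(e_i)\precsim_{\mathrm{p.w.}}z$. It has the tracial Rokhlin property if the $e_i$ can always be chosen to be projections. Proposition. Let $G$ be a countable discrete amenable group, let $A$ and $B$ be simple unital C*-algebras with $A\not\cong\mathbb{C}$, let $\alpha$ be an action of $G$ on $A$ and $\beta$ an arbitrary action of $G$ on $B$. Let $\gamma=\alpha\otimes\beta$ be the action of $G$ on the minimal tensor product $A\otimes_{\min}B$ with $\gamma_g(a\otimes b)=\alpha_g(a)\otimes\beta_g(b)$. If $\alpha$ has the weak tracial Rokhlin property, then so does $\gamma$. If $\alpha$ has the tracial Rokhlin property, then so does $\gamma$. -/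

import Mathlib

open scoped TensorProduct ENNReal Pointwise BoundedContinuousFunction
open UniformSpace (Completion)

universe u v

noncomputable section

/-! ### Minimal (spatial) tensor product of unital C*-algebras -/

/-- A unital `*`-representation of `A` on a nonzero Hilbert space. -/
structure HilbertRep (A : Type u) [CStarAlgebra A] : Type (u + 1) where
  /-- the Hilbert space -/
  H : Type u
  [instNormed : NormedAddCommGroup H]
  [instInnerProduct : InnerProductSpace ℂ H]
  [instComplete : CompleteSpace H]
  [instNontrivial : Nontrivial H]
  /-- the representation -/
  toHom : A →⋆ₐ[ℂ] (H →L[ℂ] H)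

namespace HilbertRep

attribute [instance] instNormed instInnerProduct instComplete instNontrivial

/-- The pull-back of a representation along a `*`-homomorphism. -/
abbrev comp {A A' : Type u} [CStarAlgebra A] [CStarAlgebra A'] (π : HilbertRep A)
    (φ : A' →⋆ₐ[ℂ] A) : HilbertRep A' where
  H := π.H
  toHom := π.toHom.comp φ

end HilbertRep

namespace MinTensor

section LpInfty

variable {I : Type*} {C : I → Type*} [∀ i, CStarAlgebra (C i)] [∀ i, Nontrivial (C i)]

instance : CStarAlgebra (lp C ∞) where

/-- A pointwise bounded family of `*`-homomorphisms `D → C i` as a `*`-homomorphism into the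
`ℓ^∞`-product of the `C i`. -/
def lpLift {D : Type*} [Ring D] [StarRing D] [Algebra ℂ D] (f : ∀ i, D →⋆ₐ[ℂ] C i)
    (hf : ∀ x, ∃ K : ℝ, ∀ i, ‖f i x‖ ≤ K) : D →⋆ₐ[ℂ] lp C ∞ where
  toFun x := ⟨fun i => f i x, by
    obtain ⟨K, hK⟩ := hf x
    exact memℓp_infty ⟨K, by rintro _ ⟨r, rfl⟩; exact hK r⟩⟩
  map_one' := by ext i; exact map_one (f i)
  map_mul' x y := by ext i; exact map_mul (f i) x y
  map_zero' := by ext i; exact map_zero (f i)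
  map_add' x y := by ext i; exact map_add (f i) x y
  commutes' c := by ext i; exact AlgHomClass.commutes (f i) c
  map_star' x := by ext i; exact map_star (f i) x

@[simp] theorem lpLift_apply {D : Type*} [Ring D] [StarRing D] [Algebra ℂ D]
    (f : ∀ i, D →⋆ₐ[ℂ] C i) (hf : ∀ x, ∃ K : ℝ, ∀ i, ‖f i x‖ ≤ K) (x : D) (i : I) :
    lpLift f hf x i = f i x := rfl

/-- The `i`-th coordinate of the `ℓ^∞`-product as a `*`-homomorphism. -/
def lpEval (i : I) : lp C ∞ →⋆ₐ[ℂ] C i where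
  toFun x := x i
  map_one' := rfl
  map_mul' _ _ := rfl
  map_zero' := rfl
  map_add' _ _ := rfl
  commutes' _ := rfl
  map_star' _ := rfl

end LpInfty

section Hilbert

variable {E F : Type*} [NormedAddCommGroup E] [InnerProductSpace ℂ E]
  [NormedAddCommGroup F] [InnerProductSpace ℂ F]

theorem completion_ext {S T : Completion E →L[ℂ] Completion E}
    (h : ∀ x : E, S x = T x) : S = T := by
  ext x
  induction x using Completion.induction_on with
  | hp => exact isClosed_eq (by fun_prop) (by fun_prop)
  | ih x => exact h x

theorem star_completion (S T : E →L[ℂ] E) (h : ∀ x y, inner ℂ (T x) y = inner ℂ x (S y)) :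
    star T.completion = S.completion := by
  symm
  rw [ContinuousLinearMap.star_eq_adjoint, ContinuousLinearMap.eq_adjoint_iff]
  intro x y
  induction x, y using Completion.induction_on₂ with
  | hp => exact isClosed_eq (by fun_prop) (by fun_prop)
  | ih x y =>
    simp only [ContinuousLinearMap.completion_apply_coe, Completion.inner_coe]
    rw [← inner_conj_symm, ← h, inner_conj_symm]

theorem inner_mapL [CompleteSpace E] [CompleteSpace F]
    (S : E →L[ℂ] E) (T : F →L[ℂ] F) (x y : E ⊗[ℂ] F) :
    inner ℂ (TensorProduct.mapL S T x) y =
      inner ℂ x (TensorProduct.mapL (star S) (star T) y) := by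
  induction x with
  | zero => simp
  | add x x' hx hx' => rw [map_add, inner_add_left, inner_add_left, hx, hx']
  | tmul x x' =>
    induction y with
    | zero => simp
    | add y y' hy hy' => rw [map_add, inner_add_right, inner_add_right, hy, hy']
    | tmul y y' =>
      simp [ContinuousLinearMap.star_eq_adjoint, ContinuousLinearMap.adjoint_inner_right]

/-- The operator `S ⊗ T` on the Hilbert space tensor product of `E` and `F`, that is, on the
completion of `E ⊗ F` for the inner product `⟪x ⊗ y, x' ⊗ y'⟫ = ⟪x, x'⟫ * ⟪y, y'⟫`. -/
def tensorOp (S : E →L[ℂ] E) (T : F →L[ℂ] F) :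
    Completion (E ⊗[ℂ] F) →L[ℂ] Completion (E ⊗[ℂ] F) :=
  (TensorProduct.mapL S T).completion

@[simp] theorem tensorOp_coe (S : E →L[ℂ] E) (T : F →L[ℂ] F) (x : E ⊗[ℂ] F) :
    tensorOp S T x = (TensorProduct.mapL S T x : E ⊗[ℂ] F) := by
  simp [tensorOp]

/-- `tensorOp` as a bilinear map. -/
def tensorOpBilin :
    (E →L[ℂ] E) →ₗ[ℂ] (F →L[ℂ] F) →ₗ[ℂ]
      (Completion (E ⊗[ℂ] F) →L[ℂ] Completion (E ⊗[ℂ] F)) :=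
  LinearMap.mk₂ ℂ tensorOp
    (fun _ _ _ => completion_ext fun x => by simp [TensorProduct.mapL_add_left, Completion.coe_add])
    (fun _ _ _ => completion_ext fun x => by simp [TensorProduct.mapL_smul_left])
    (fun _ _ _ => completion_ext fun x => by simp [TensorProduct.mapL_add_right, Completion.coe_add])
    (fun _ _ _ => completion_ext fun x => by simp [TensorProduct.mapL_smul_right])

theorem tensorOp_mul (S S' : E →L[ℂ] E) (T T' : F →L[ℂ] F) :
    tensorOp (S * S') (T * T') = tensorOp S T * tensorOp S' T' :=
  completion_ext fun x => by simp [TensorProduct.mapL_mul]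

theorem tensorOp_one : tensorOp (1 : E →L[ℂ] E) (1 : F →L[ℂ] F) = 1 :=
  completion_ext fun x => by
    simp [show (1 : E →L[ℂ] E) = .id ℂ E from rfl, show (1 : F →L[ℂ] F) = .id ℂ F from rfl]

theorem tensorOp_star [CompleteSpace E] [CompleteSpace F] (S : E →L[ℂ] E) (T : F →L[ℂ] F) :
    tensorOp (star S) (star T) = star (tensorOp S T) :=
  (star_completion _ _ (inner_mapL S T)).symm

variable (E F) in
/-- The algebra of bounded operators on the Hilbert space tensor product of `E` and `F`. -/
def TensorB : Type _ := Completion (E ⊗[ℂ] F) →L[ℂ] Completion (E ⊗[ℂ] F)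

instance : CStarAlgebra (TensorB E F) :=
  inferInstanceAs (CStarAlgebra (Completion (E ⊗[ℂ] F) →L[ℂ] Completion (E ⊗[ℂ] F)))

instance [Nontrivial E] [Nontrivial F] : Nontrivial (Completion (E ⊗[ℂ] F)) := by
  obtain ⟨x, hx⟩ := exists_ne (0 : E)
  obtain ⟨y, hy⟩ := exists_ne (0 : F)
  refine ⟨⟨((x ⊗ₜ[ℂ] y : E ⊗[ℂ] F) : Completion (E ⊗[ℂ] F)), 0, fun h => ?_⟩⟩
  have := congrArg norm h
  simp [hx, hy] at this

instance [Nontrivial E] [Nontrivial F] : Nontrivial (TensorB E F) :=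
  inferInstanceAs (Nontrivial (Completion (E ⊗[ℂ] F) →L[ℂ] Completion (E ⊗[ℂ] F)))

end Hilbert

variable {A : Type u} {B : Type v} [CStarAlgebra A] [CStarAlgebra B]

/-- The algebra `B(H ⊗ K)` on which the representation `π ⊗ ρ` takes its values. -/
abbrev RepAlg (r : HilbertRep A × HilbertRep B) : Type (max u v) := TensorB r.1.H r.2.H

/-- The representation `π ⊗ ρ` of the algebraic tensor product `A ⊗ B`, determined by
`(π ⊗ ρ) (a ⊗ b) = π a ⊗ ρ b`. -/
def repHom (r : HilbertRep A × HilbertRep B) : A ⊗[ℂ] B →⋆ₐ[ℂ] RepAlg r :=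
  let f : A ⊗[ℂ] B →ₐ[ℂ] (Completion (r.1.H ⊗[ℂ] r.2.H) →L[ℂ] Completion (r.1.H ⊗[ℂ] r.2.H)) :=
    Algebra.TensorProduct.algHomOfLinearMapTensorProduct
      (TensorProduct.lift
        (tensorOpBilin.compl₁₂ r.1.toHom.toLinearMap r.2.toHom.toLinearMap))
      (fun a a' b b' => by simp [tensorOpBilin, tensorOp_mul])
      (by simp [tensorOpBilin, tensorOp_one])
  { f with
    map_star' := fun x => by
      change f (star x) = star (f x)
      induction x with
      | zero => rw [star_zero, map_zero]; exact (star_zero (Completion (r.1.H ⊗[ℂ] r.2.H) →L[ℂ] Completion (r.1.H ⊗[ℂ] r.2.H))).symm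
      | add x y hx hy =>
        rw [star_add, map_add, map_add, hx, hy]
        exact (star_add (f x) (f y)).symm
      | tmul a b => simp [f, tensorOpBilin, TensorProduct.star_tmul, tensorOp_star, map_star] }

theorem repHom_tmul (r : HilbertRep A × HilbertRep B) (a : A) (b : B) :
    repHom r (a ⊗ₜ[ℂ] b) = tensorOp (r.1.toHom a) (r.2.toHom b) := rfl

theorem norm_repHom_bdd (x : A ⊗[ℂ] B) :
    ∃ C : ℝ, ∀ r : HilbertRep A × HilbertRep B, ‖repHom r x‖ ≤ C := by
  induction x with
  | zero => exact ⟨0, fun r => by simp⟩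
  | add x y hx hy =>
    obtain ⟨C, hC⟩ := hx
    obtain ⟨D, hD⟩ := hy
    exact ⟨C + D, fun r => by
      rw [map_add]
      exact (norm_add_le _ _).trans (add_le_add (hC r) (hD r))⟩
  | tmul a b =>
    refine ⟨‖a‖ * ‖b‖, fun r => ?_⟩
    have h : repHom r (a ⊗ₜ[ℂ] b) = repHom r (a ⊗ₜ[ℂ] 1) * repHom r (1 ⊗ₜ[ℂ] b) := by
      rw [← map_mul]; simp
    let f : A →⋆ₐ[ℂ] RepAlg r := (repHom r).comp
      { Algebra.TensorProduct.includeLeft with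
        map_star' := fun a => by simp [TensorProduct.star_tmul] }
    let g : B →⋆ₐ[ℂ] RepAlg r := (repHom r).comp
      { Algebra.TensorProduct.includeRight with
        map_star' := fun a => by simp [TensorProduct.star_tmul] }
    rw [h]
    exact (norm_mul_le _ _).trans (mul_le_mul (NonUnitalStarAlgHom.norm_apply_le f a)
      (NonUnitalStarAlgHom.norm_apply_le g b) (norm_nonneg _) (norm_nonneg _))

variable (A B) in
/-- The `ℓ^∞`-product of the algebras `B(H ⊗ K)`, over all pairs of representations
`A → B(H)`, `B → B(K)`. -/
abbrev RepProd : Type (max (u + 1) (v + 1)) :=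
  lp (fun r : HilbertRep A × HilbertRep B => RepAlg r) ∞

variable (A B) in
/-- The `*`-homomorphism from the algebraic tensor product `A ⊗ B` to the product of all
`B(H ⊗ K)` whose coordinates are the representations `π ⊗ ρ`.  The norm of the image of `x` is
`sup ‖(π ⊗ ρ) x‖`, the minimal C*-norm of `x`. -/
def toRepProd : A ⊗[ℂ] B →⋆ₐ[ℂ] RepProd A B := lpLift repHom norm_repHom_bdd

end MinTensor

/-- The minimal (spatial) tensor product of unital C*-algebras: the completion of the algebraic
tensor product `A ⊗ B` for the norm `x ↦ sup ‖(π ⊗ ρ) x‖`, over all representations `π` of `A` and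
`ρ` of `B`, realised as the closure of the image of `A ⊗ B` in the product of all `B(H ⊗ K)`. -/
def MinTensor (A : Type u) (B : Type v) [CStarAlgebra A] [CStarAlgebra B] :
    Type (max (u + 1) (v + 1)) :=
  (MinTensor.toRepProd A B).range.topologicalClosure

namespace MinTensor

instance (A : Type u) (B : Type v) [CStarAlgebra A] [CStarAlgebra B] :
    CStarAlgebra (MinTensor A B) :=
  haveI : IsClosed ((toRepProd A B).range.topologicalClosure : Set (RepProd A B)) :=
    StarSubalgebra.isClosed_topologicalClosure _
  inferInstanceAs (CStarAlgebra (toRepProd A B).range.topologicalClosure)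

variable {A A' A'' : Type u} {B B' B'' : Type v} [CStarAlgebra A] [CStarAlgebra A']
  [CStarAlgebra A''] [CStarAlgebra B] [CStarAlgebra B'] [CStarAlgebra B'']

/-- The elementary tensor `a ⊗ b`. -/
def tmul (a : A) (b : B) : MinTensor A B :=
  ⟨toRepProd A B (a ⊗ₜ b), StarSubalgebra.le_topologicalClosure _ ⟨a ⊗ₜ b, rfl⟩⟩

/-- The `*`-homomorphism `∏ B(H ⊗ K) → ∏ B(H' ⊗ K')` whose coordinate at `(π', ρ')` is the
coordinate at `(π' ∘ φ, ρ' ∘ ψ)`. -/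
def reindex (φ : A →⋆ₐ[ℂ] A') (ψ : B →⋆ₐ[ℂ] B') : RepProd A B →⋆ₐ[ℂ] RepProd A' B' :=
  lpLift (C := fun r : HilbertRep A' × HilbertRep B' => RepAlg r)
    (fun r => (lpEval (r.1.comp φ, r.2.comp ψ) :
      RepProd A B →⋆ₐ[ℂ] RepAlg (r.1.comp φ, r.2.comp ψ)))
    (fun x => ⟨‖x‖, fun r =>
      lp.norm_apply_le_norm ENNReal.top_ne_zero x (r.1.comp φ, r.2.comp ψ)⟩)

theorem reindex_toRepProd (φ : A →⋆ₐ[ℂ] A') (ψ : B →⋆ₐ[ℂ] B') (x : A ⊗[ℂ] B) :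
    reindex φ ψ (toRepProd A B x) =
      toRepProd A' B' (TensorProduct.map φ.toLinearMap ψ.toLinearMap x) := by
  induction x with
  | zero => simp
  | add x y hx hy => simp only [map_add, hx, hy]
  | tmul a b => rfl

theorem reindex_mem (φ : A →⋆ₐ[ℂ] A') (ψ : B →⋆ₐ[ℂ] B') (x : RepProd A B)
    (hx : x ∈ (toRepProd A B).range.topologicalClosure) :
    reindex φ ψ x ∈ (toRepProd A' B').range.topologicalClosure := by
  have hc : Continuous (reindex φ ψ) :=
    AddMonoidHomClass.continuous_of_bound (reindex φ ψ) 1 fun y => by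
      simpa using NonUnitalStarAlgHom.norm_apply_le (reindex φ ψ) y
  refine map_mem_closure hc hx ?_
  rintro _ ⟨y, rfl⟩
  exact ⟨_, (reindex_toRepProd φ ψ y).symm⟩

/-- The `*`-homomorphism `φ ⊗ ψ` between minimal tensor products. -/
def map (φ : A →⋆ₐ[ℂ] A') (ψ : B →⋆ₐ[ℂ] B') : MinTensor A B →⋆ₐ[ℂ] MinTensor A' B' :=
  ((reindex φ ψ).comp (toRepProd A B).range.topologicalClosure.subtype).codRestrict
    (toRepProd A' B').range.topologicalClosure (fun x => reindex_mem φ ψ x x.2)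

theorem map_tmul (φ : A →⋆ₐ[ℂ] A') (ψ : B →⋆ₐ[ℂ] B') (a : A) (b : B) :
    map φ ψ (tmul a b) = tmul (φ a) (ψ b) :=
  Subtype.ext (reindex_toRepProd φ ψ (a ⊗ₜ b))

theorem map_id (x : MinTensor A B) :
    map (StarAlgHom.id ℂ A) (StarAlgHom.id ℂ B) x = x := rfl

theorem map_map (φ : A →⋆ₐ[ℂ] A') (ψ : B →⋆ₐ[ℂ] B') (φ' : A' →⋆ₐ[ℂ] A'') (ψ' : B' →⋆ₐ[ℂ] B'')
    (x : MinTensor A B) : map φ' ψ' (map φ ψ x) = map (φ'.comp φ) (ψ'.comp ψ) x := rfl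

/-- The automorphism `φ ⊗ ψ` of the minimal tensor product, for automorphisms `φ`, `ψ`. -/
def congr (φ : A ≃⋆ₐ[ℂ] A) (ψ : B ≃⋆ₐ[ℂ] B) : MinTensor A B ≃⋆ₐ[ℂ] MinTensor A B :=
  StarAlgEquiv.ofStarAlgHom (map φ.toStarAlgHom ψ.toStarAlgHom)
    (map φ.symm.toStarAlgHom ψ.symm.toStarAlgHom)
    (by
      ext1 x
      refine (map_map _ _ _ _ x).trans ?_
      rw [show φ.symm.toStarAlgHom.comp φ.toStarAlgHom = .id ℂ A by ext; simp,
        show ψ.symm.toStarAlgHom.comp ψ.toStarAlgHom = .id ℂ B by ext; simp]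
      rfl)
    (by
      ext1 x
      refine (map_map _ _ _ _ x).trans ?_
      rw [show φ.toStarAlgHom.comp φ.symm.toStarAlgHom = .id ℂ A by ext; simp,
        show ψ.toStarAlgHom.comp ψ.symm.toStarAlgHom = .id ℂ B by ext; simp]
      rfl)

theorem congr_tmul (φ : A ≃⋆ₐ[ℂ] A) (ψ : B ≃⋆ₐ[ℂ] B) (a : A) (b : B) :
    congr φ ψ (tmul a b) = tmul (φ a) (ψ b) :=
  map_tmul φ.toStarAlgHom ψ.toStarAlgHom a b

/-- The action `α ⊗ β` on the minimal tensor product: `(α ⊗ β)_g = α_g ⊗ β_g`. -/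
def action {G : Type*} [Group G] (α : G →* (A ≃⋆ₐ[ℂ] A)) (β : G →* (B ≃⋆ₐ[ℂ] B)) :
    G →* (MinTensor A B ≃⋆ₐ[ℂ] MinTensor A B) where
  toFun g := congr (α g) (β g)
  map_one' := by rw [_root_.map_one, _root_.map_one]; rfl
  map_mul' g h := by rw [_root_.map_mul, _root_.map_mul]; rfl

end MinTensor

/-! ### Ultrapowers and central sequences -/

section Ultrapower

open Filter Topology

/-- The ideal `c_ω(A)` of `ℓ^∞(ℕ, A)`: bounded sequences with `lim_{n → ω} ‖x n‖ = 0`. -/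
def cOmega (ω : Ultrafilter ℕ) (A : Type*) [CStarAlgebra A] : Ideal (ℕ →ᵇ A) where
  carrier := {x | Tendsto (fun n => ‖x n‖) ω (𝓝 0)}
  zero_mem' := by simp
  add_mem' {x y} hx hy := by
    refine squeeze_zero (fun n => norm_nonneg _) (fun n => norm_add_le (x n) (y n)) ?_
    simpa using hx.add hy
  smul_mem' c x hx := by
    refine squeeze_zero (fun n => norm_nonneg _) (fun n => (norm_mul_le (c n) (x n)).trans
      (mul_le_mul_of_nonneg_right (c.norm_coe_le_norm n) (norm_nonneg _))) ?_
    simpa using hx.const_mul ‖c‖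

variable (ω : Ultrafilter ℕ) (A : Type*) [CStarAlgebra A] {B : Type*} [CStarAlgebra B]

theorem mem_cOmega {x : ℕ →ᵇ A} :
    x ∈ cOmega ω A ↔ Tendsto (fun n => ‖x n‖) ω (𝓝 0) := Iff.rfl

instance : (cOmega ω A).IsTwoSided where
  mul_mem_of_left {x} c hx := by
    refine squeeze_zero (fun n => norm_nonneg _) (fun n => (norm_mul_le (x n) (c n)).trans
      (mul_le_mul_of_nonneg_left (c.norm_coe_le_norm n) (norm_nonneg _))) ?_
    simpa using Tendsto.mul_const ‖c‖ hx

/-- The ultrapower `A^ω = ℓ^∞(ℕ, A) / c_ω(A)`, with its quotient ring structure and quotient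
norm. -/
abbrev Ultrapower : Type _ := (ℕ →ᵇ A) ⧸ cOmega ω A

/-- The class in `A^ω` of a bounded sequence. -/
abbrev Ultrapower.mk : (ℕ →ᵇ A) →+* Ultrapower ω A := Ideal.Quotient.mk (cOmega ω A)

theorem star_mem_cOmega {x : ℕ →ᵇ A} (hx : x ∈ cOmega ω A) : star x ∈ cOmega ω A := by
  rw [mem_cOmega] at hx ⊢
  simpa using hx

instance : Star (Ultrapower ω A) where
  star := Quotient.map' star fun x y h => by
    rw [Submodule.quotientRel_def] at h ⊢
    rw [← star_sub]
    exact star_mem_cOmega ω A h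

theorem Ultrapower.star_mk (x : ℕ →ᵇ A) : star (mk ω A x) = mk ω A (star x) := rfl

instance : StarRing (Ultrapower ω A) where
  star_involutive x := by
    obtain ⟨x, rfl⟩ := Ideal.Quotient.mk_surjective x
    exact congrArg (Ultrapower.mk ω A) (star_star x)
  star_mul x y := by
    obtain ⟨x, rfl⟩ := Ideal.Quotient.mk_surjective x
    obtain ⟨y, rfl⟩ := Ideal.Quotient.mk_surjective y
    exact congrArg (Ultrapower.mk ω A) (star_mul x y)
  star_add x y := by
    obtain ⟨x, rfl⟩ := Ideal.Quotient.mk_surjective x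
    obtain ⟨y, rfl⟩ := Ideal.Quotient.mk_surjective y
    exact congrArg (Ultrapower.mk ω A) (star_add x y)

/-- The central sequence algebra `A_ω = A^ω ∩ A'`, with `A` embedded in `A^ω` as the constant
sequences. -/
def centralSequences : Subring (Ultrapower ω A) :=
  Subring.centralizer (Set.range fun a : A =>
    Ultrapower.mk ω A (BoundedContinuousFunction.const ℕ a))

variable {A}

/-- The entrywise application of a `*`-homomorphism to bounded sequences. -/
def seqMap (φ : A →⋆ₐ[ℂ] B) : (ℕ →ᵇ A) →+* (ℕ →ᵇ B) where
  toFun x := BoundedContinuousFunction.ofNormedAddCommGroup (fun n => φ (x n))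
    continuous_of_discreteTopology ‖x‖ fun n =>
      (NonUnitalStarAlgHom.norm_apply_le φ (x n)).trans (x.norm_coe_le_norm n)
  map_one' := by ext n; exact map_one φ
  map_mul' x y := by ext n; exact map_mul φ (x n) (y n)
  map_zero' := by ext n; exact map_zero φ
  map_add' x y := by ext n; exact map_add φ (x n) (y n)

/-- The extension of a `*`-homomorphism `A → B` to `A^ω → B^ω`. -/
def Ultrapower.map (φ : A →⋆ₐ[ℂ] B) : Ultrapower ω A →+* Ultrapower ω B :=
  Ideal.Quotient.lift (cOmega ω A) ((Ultrapower.mk ω B).comp (seqMap φ)) fun x hx => by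
    refine Ideal.Quotient.eq_zero_iff_mem.mpr ?_
    exact squeeze_zero (fun n => norm_nonneg _)
      (fun n => NonUnitalStarAlgHom.norm_apply_le φ (x n)) hx

end Ultrapower

/-! ### The tracial Rokhlin property -/

section Rokhlin

open Filter Topology

/-- Positive elements of a C*-algebra: those of the form `y* y`. -/
def IsPos {R : Type*} [Mul R] [Star R] (x : R) : Prop := ∃ y, x = star y * y

/-- Cuntz subequivalence `a ≾ b` in `A`: there are `v n` with `v n * b * (v n)* → a`. -/
def CuntzLE {A : Type*} [CStarAlgebra A] (a b : A) : Prop :=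
  ∃ v : ℕ → A, Tendsto (fun n => v n * b * star (v n)) atTop (𝓝 a)

/-- Pointwise Cuntz subequivalence `f ≾ a` of `f ∈ A^ω` to `a ∈ A`: `f` is represented by a bounded
sequence of positive elements, each of which is Cuntz subequivalent to `a`. -/
def PointwiseCuntzLE {ω : Ultrafilter ℕ} {A : Type*} [CStarAlgebra A]
    (f : Ultrapower ω A) (a : A) : Prop :=
  ∃ x : ℕ →ᵇ A, Ultrapower.mk ω A x = f ∧ ∀ n, IsPos (x n) ∧ CuntzLE (x n) a

/-- A C*-algebra is simple if it is nonzero and has no nontrivial closed two-sided ideals. -/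
def IsSimpleCStar (A : Type*) [CStarAlgebra A] : Prop :=
  Nontrivial A ∧ ∀ I : TwoSidedIdeal A, IsClosed (I : Set A) → I = ⊥ ∨ I = ⊤

variable {G : Type*} [Group G]

/-- A nonempty finite subset `T` of `G` is `(K, ε)`-invariant if
`|T ∩ ⋂_{g ∈ K} g T| ≥ (1 - ε) |T|`. -/
def IsInvariantSet (K : Finset G) (ε : ℝ) (T : Finset G) : Prop :=
  T.Nonempty ∧
    (1 - ε) * (T.card : ℝ) ≤ (((T : Set G) ∩ ⋂ g ∈ K, g • (T : Set G)).ncard : ℝ)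

variable (G) in
/-- Amenability of a discrete group (Følner's condition). -/
def IsAmenableGroup : Prop :=
  ∀ (K : Finset G) (ε : ℝ), 0 < ε → ∃ T : Finset G, IsInvariantSet K ε T

variable {A : Type*} [CStarAlgebra A]

/-- The common form of the two Rokhlin properties: for every finite `K ⊆ G`, `ε > 0` and nonzero
positive `z ∈ A` there are `(K, ε)`-invariant sets `T_1, …, T_n` and elements `e_1, …, e_n` of `A_ω`
with the property `P` such that `α_g(e_i) α_h(e_j) = 0` for `g ∈ T_i`, `h ∈ T_j` with
`(g, i) ≠ (h, j)`, and `1 - ∑_i ∑_{g ∈ T_i} α_g(e_i)` is pointwise Cuntz subequivalent to `z`. -/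
def HasRokhlinTowers (ω : Ultrafilter ℕ) (P : Ultrapower ω A → Prop)
    (α : G →* (A ≃⋆ₐ[ℂ] A)) : Prop :=
  ∀ (K : Finset G) (ε : ℝ), 0 < ε → ∀ z : A, IsPos z → z ≠ 0 →
    ∃ (n : ℕ) (T : Fin n → Finset G) (e : Fin n → Ultrapower ω A),
      0 < n ∧
      (∀ i, IsInvariantSet K ε (T i)) ∧
      (∀ i, e i ∈ centralSequences ω A ∧ P (e i)) ∧
      (∀ i j, ∀ g ∈ T i, ∀ h ∈ T j, (g ≠ h ∨ i ≠ j) →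
        Ultrapower.map ω (α g).toStarAlgHom (e i) *
          Ultrapower.map ω (α h).toStarAlgHom (e j) = 0) ∧
      PointwiseCuntzLE
        (1 - ∑ i, ∑ g ∈ T i, Ultrapower.map ω (α g).toStarAlgHom (e i)) z

/-- The tracial Rokhlin property (with projections `e_i`). -/
def TracialRokhlin (ω : Ultrafilter ℕ) (α : G →* (A ≃⋆ₐ[ℂ] A)) : Prop :=
  HasRokhlinTowers ω (fun e => IsStarProjection e) α

/-- The weak tracial Rokhlin property (with positive contractions `e_i`). -/
def WeakTracialRokhlin (ω : Ultrafilter ℕ) (α : G →* (A ≃⋆ₐ[ℂ] A)) : Prop :=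
  HasRokhlinTowers ω (fun e => IsPos e ∧ ‖e‖ ≤ 1) α

end Rokhlin

end

/-! The proof carries towers for `α` along the embedding `a ↦ a ⊗ 1`. This embedding is equivariant
and preserves the tower relations, positivity, contractivity and projections. It sends central
sequences to central sequences because a commutator with `a ⊗ b` is `[x n, a] ⊗ b`. Only the size of
the remainder needs work: it must be below a prescribed nonzero positive `z` in the tensor product.
So everything rests on `MinTensor.exists_inl_le_conj`: under each such `z` there is, up to
conjugation, some `a ⊗ 1` with `a` nonzero and positive. The Rokhlin property of `α` is then applied
to this `a`.

That comparison has three ingredients. Kirchberg's slice lemma (`MinTensor.exists_tmul_le_conj`)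
puts a nonzero `a ⊗ b` under a conjugate of `z`. It is proved by slicing `z` with a vector state of
`A` and excising the second tensor factors by one norm-one element of `B`, without pure states
(`exists_nonneg_norm_one_excision`). Simplicity of `B` gives finitely many `c i` with `1 ≤ ∑ c i * b
* star (c i)`. Finally, if `A` is simple without minimal projections, there are `d i` with `d i * a
* star (d j)` equal to a fixed nonzero `a'` when `i = j` and to `0` otherwise. Conjugating `a ⊗ b`
by `∑ d i ⊗ c i` then yields at least `a' ⊗ 1`.

Minimal projections are excluded by the Rokhlin property itself when `G` is nontrivial
(`HasRokhlinTowers.not_isMinimalProjection`). In a simple algebra with a minimal projection `p`,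
central sequences are asymptotically scalar, so towers with at least two levels vanish, the unit is
dominated by `p`, and the algebra is one-dimensional. For trivial `G` the tower `e = 1` always
works. -/

open Filter Topology

/-! ### Cuntz subequivalence and functional calculus -/

section Cuntz

variable {D : Type*} [CStarAlgebra D]

theorem CuntzLE.of_forall_exists {a b : D} (h : ∀ ε > 0, ∃ v : D, ‖v * b * star v - a‖ < ε) :
    CuntzLE a b := by
  choose v hv using fun n : ℕ => h (1 / ((n : ℝ) + 1)) (by positivity)
  refine ⟨v, tendsto_iff_norm_sub_tendsto_zero.mpr ?_⟩
  exact squeeze_zero (fun _ => norm_nonneg _) (fun n => (hv n).le)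
    tendsto_one_div_add_atTop_nhds_zero_nat

theorem CuntzLE.exists_norm_sub_lt {a b : D} (h : CuntzLE a b) {ε : ℝ} (hε : 0 < ε) :
    ∃ v : D, ‖v * b * star v - a‖ < ε := by
  obtain ⟨v, hv⟩ := h
  obtain ⟨n, hn⟩ := ((tendsto_iff_norm_sub_tendsto_zero.mp hv).eventually_lt_const hε).exists
  exact ⟨v n, hn⟩

theorem CuntzLE.trans {a b c : D} (hab : CuntzLE a b) (hbc : CuntzLE b c) : CuntzLE a c := by
  refine .of_forall_exists fun ε hε => ?_
  obtain ⟨v, hv⟩ := hab.exists_norm_sub_lt (half_pos hε)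
  have hM : 0 < ‖v‖ * ‖v‖ + 1 := by positivity
  obtain ⟨w, hw⟩ := hbc.exists_norm_sub_lt (div_pos (half_pos hε) hM)
  refine ⟨v * w, ?_⟩
  have h1 : v * w * c * star (v * w) - a =
      v * (w * c * star w - b) * star v + (v * b * star v - a) := by
    rw [star_mul]; noncomm_ring
  have h2 : ‖v * (w * c * star w - b) * star v‖ ≤ ε / 2 := by
    calc _ ≤ ‖v‖ * ‖w * c * star w - b‖ * ‖star v‖ := norm_mul₃_le
      _ = (‖v‖ * ‖v‖) * ‖w * c * star w - b‖ := by rw [norm_star]; ring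
      _ ≤ (‖v‖ * ‖v‖ + 1) * (ε / 2 / (‖v‖ * ‖v‖ + 1)) := by gcongr; linarith
      _ = ε / 2 := by field_simp
  rw [h1]
  linarith [norm_add_le (v * (w * c * star w - b) * star v) (v * b * star v - a)]

theorem CuntzLE.conj (v b : D) : CuntzLE (v * b * star v) b :=
  ⟨fun _ => v, tendsto_const_nhds⟩

theorem CuntzLE.map {E : Type*} [CStarAlgebra E] (φ : D →⋆ₐ[ℂ] E) {a b : D} (h : CuntzLE a b) :
    CuntzLE (φ a) (φ b) := by
  obtain ⟨v, hv⟩ := h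
  refine ⟨fun n => φ (v n), ?_⟩
  have := ((AddMonoidHomClass.continuous_of_bound φ 1 fun y => by
      simpa using NonUnitalStarAlgHom.norm_apply_le φ y).tendsto a).comp hv
  simpa [Function.comp_def, map_star] using this

theorem cfc_mul_self_mul {f : ℝ → ℝ} (hf : Continuous f) {y : D} (hy : IsSelfAdjoint y) :
    cfc f y * y * cfc f y = cfc (fun t => f t * t * f t) y := by
  rw [cfc_mul (fun t => f t * t) f y (by fun_prop) (by fun_prop),
    cfc_mul f (fun t => t) y (by fun_prop) (by fun_prop), cfc_id' ℝ y]

variable [PartialOrder D] [StarOrderedRing D]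

theorem isPos_iff_nonneg {x : D} : IsPos x ↔ 0 ≤ x :=
  CStarAlgebra.nonneg_iff_eq_star_mul_self.symm

/-- The conjugator is the regularised quotient `a^{1/2} max(b, δ)^{-1/2}`. It misses `a` by `a^{1/2}
Q² a^{1/2}` with `Q² = (1 - b/δ)₊`; by the C*-identity the norm of this is `‖Q a Q‖ ≤ ‖Q b Q‖ ≤ δ`.
-/
theorem CuntzLE.of_le {a b : D} (ha : 0 ≤ a) (hab : a ≤ b) : CuntzLE a b := by
  refine .of_forall_exists fun ε hε => ?_
  have hb : 0 ≤ b := ha.trans hab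
  have hbs : IsSelfAdjoint b := .of_nonneg hb
  have hδ : 0 < ε / 2 := half_pos hε
  set δ := ε / 2 with hδε
  let s : ℝ → ℝ := fun t => (√(max t δ))⁻¹
  let q : ℝ → ℝ := fun t => √(max 0 (1 - t / δ))
  have hs : Continuous s := Continuous.inv₀ (by fun_prop) fun t =>
    (Real.sqrt_pos.mpr (lt_max_of_lt_right hδ)).ne'
  have hq : Continuous q := by fun_prop
  set r := CFC.sqrt a with hr
  have hrr : r * r = a := CFC.sqrt_mul_sqrt_self a ha
  have hrs : star r = r := (IsSelfAdjoint.of_nonneg (CFC.sqrt_nonneg a)).star_eq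
  set S := cfc s b with hS
  set Q := cfc q b with hQ
  have hSs : star S = S := (cfc_predicate s b : IsSelfAdjoint _).star_eq
  have hQs : star Q = Q := (cfc_predicate q b : IsSelfAdjoint _).star_eq
  have hSQ : S * b * S = 1 - Q * Q := by
    rw [hS, hQ, cfc_mul_self_mul hs hbs, ← cfc_mul q q b, ← cfc_one ℝ b,
      ← cfc_sub _ _ b (by fun_prop) (by fun_prop)]
    refine cfc_congr fun t ht => ?_
    have ht0 : 0 ≤ t := spectrum_nonneg_of_nonneg hb ht
    have h1 : (s t) * t * s t = t / max t δ := by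
      have : √(max t δ) * √(max t δ) = max t δ := Real.mul_self_sqrt (by positivity)
      calc _ = t / (√(max t δ) * √(max t δ)) := by simp only [s]; field_simp
        _ = _ := by rw [this]
    have h2 : q t * q t = max 0 (1 - t / δ) := Real.mul_self_sqrt (le_max_left _ _)
    simp only [h1, h2, Pi.one_apply]
    rcases le_total t δ with h | h
    · rw [max_eq_right h, max_eq_right (by rw [sub_nonneg]; exact (div_le_one hδ).mpr h)]; ring
    · rw [max_eq_left h, max_eq_left (by rw [sub_nonpos]; exact (one_le_div hδ).mpr h),
        div_self (by linarith), sub_zero]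
  refine ⟨r * S, ?_⟩
  have h1 : r * S * b * star (r * S) - a = -(r * Q * (Q * r)) := by
    calc _ = r * (S * b * S) * r - r * r := by rw [star_mul, hSs, hrs, hrr]; noncomm_ring
      _ = _ := by rw [hSQ]; noncomm_ring
  have h2 : ‖r * Q * (Q * r)‖ = ‖Q * a * Q‖ := by
    calc _ = ‖star (Q * r) * (Q * r)‖ := by rw [star_mul, hQs, hrs]
      _ = ‖star (star (Q * r)) * star (Q * r)‖ := by
        rw [CStarRing.norm_star_mul_self, CStarRing.norm_star_mul_self, norm_star]
      _ = _ := by rw [star_star, star_mul, hQs, hrs, ← hrr]; noncomm_ring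
  have h3 : ‖Q * a * Q‖ ≤ ‖Q * b * Q‖ :=
    CStarAlgebra.norm_le_norm_of_nonneg_of_le
      (by simpa [hQs] using star_left_conjugate_nonneg ha Q)
      (by simpa [hQs] using star_left_conjugate_le_conjugate hab Q)
  have h4 : ‖Q * b * Q‖ ≤ δ := by
    rw [hQ, cfc_mul_self_mul hq hbs]
    refine norm_cfc_le hδ.le fun t ht => ?_
    have ht0 : 0 ≤ t := spectrum_nonneg_of_nonneg hb ht
    have h2 : q t * q t = max 0 (1 - t / δ) := Real.mul_self_sqrt (le_max_left _ _)
    have h5 : q t * t * q t = t * max 0 (1 - t / δ) := by rw [← h2]; ring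
    rw [h5, Real.norm_of_nonneg (by positivity)]
    rcases le_total t δ with h | h
    · calc t * max 0 (1 - t / δ) ≤ t * 1 := by gcongr; simp; positivity
        _ ≤ δ := by linarith
    · rw [max_eq_left (by rw [sub_nonpos]; exact (one_le_div hδ).mpr h)]; simpa using hδ.le
  rw [h1, norm_neg, h2]
  linarith

/-- An approximate eigenvector for the top of the spectrum: a tent function of `x` centred at `‖x‖`.
It has norm one because `‖x‖` belongs to the spectrum of a positive element. -/
theorem exists_nonneg_norm_one_mul_sub_le [Nontrivial D] {x : D} (hx : 0 ≤ x) {δ : ℝ}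
    (hδ : 0 < δ) : ∃ h : D, 0 ≤ h ∧ ‖h‖ = 1 ∧ ‖x * h - ‖x‖ • h‖ ≤ δ := by
  have hxs : IsSelfAdjoint x := .of_nonneg hx
  let f : ℝ → ℝ := fun t => max 0 (1 - |t - ‖x‖| / δ)
  have hf : Continuous f := by fun_prop
  have hf0 : ∀ t, 0 ≤ f t := fun t => le_max_left _ _
  have hf1 : ∀ t, f t ≤ 1 := fun t => max_le zero_le_one (by simp; positivity)
  refine ⟨cfc f x, cfc_nonneg fun t _ => hf0 t, le_antisymm ?_ ?_, ?_⟩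
  · exact norm_cfc_le zero_le_one fun t _ => by rw [Real.norm_of_nonneg (hf0 t)]; exact hf1 t
  · have := norm_apply_le_norm_cfc f x (CStarAlgebra.norm_mem_spectrum_of_nonneg hx)
    simpa [f] using this
  · have h1 : x * cfc f x - ‖x‖ • cfc f x = cfc (fun t => t * f t - ‖x‖ * f t) x := by
      rw [cfc_sub _ _ x (by fun_prop) (by fun_prop), cfc_const_mul ‖x‖ f x,
        cfc_mul (fun t => t) f x (by fun_prop) (by fun_prop), cfc_id' ℝ x]
    rw [h1]
    refine norm_cfc_le hδ.le fun t _ => ?_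
    rw [← sub_mul, norm_mul, Real.norm_of_nonneg (hf0 t), Real.norm_eq_abs]
    rcases le_total |t - ‖x‖| δ with h | h
    · calc _ ≤ |t - ‖x‖| * 1 := by gcongr; exact hf1 t
        _ ≤ δ := by linarith
    · have : f t = 0 := max_eq_left (by rw [sub_nonpos]; exact (one_le_div hδ).mpr h)
      rw [this]; simpa using hδ.le

/-- Take `k = (y - s)₊`: on its support the spectral parameter is at least `s`, and it vanishes only
if the spectrum lies below `s`. -/
theorem exists_nonneg_smul_le_conj {y : D} (hy : IsSelfAdjoint y) (s : ℝ) :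
    ∃ k : D, 0 ≤ k ∧ s • (k * k) ≤ k * y * k ∧ (k = 0 → y ≤ algebraMap ℝ D s) := by
  let f : ℝ → ℝ := fun t => max 0 (t - s)
  have hf : Continuous f := by fun_prop
  refine ⟨cfc f y, cfc_nonneg fun t _ => le_max_left _ _, ?_, fun h => ?_⟩
  · rw [cfc_mul_self_mul hf hy, ← cfc_mul f f y, ← cfc_const_mul s _ y]
    refine cfc_mono fun t _ => ?_
    rcases le_total t s with h | h
    · have : f t = 0 := max_eq_left (by linarith)
      simp [this]
    · nlinarith [mul_nonneg (sub_nonneg.mpr h) (mul_self_nonneg (f t))]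
  · conv_lhs => rw [← cfc_id' ℝ y]
    refine cfc_le_algebraMap _ _ _ fun t ht => ?_
    have h1 : f t = 0 := by
      have := norm_apply_le_norm_cfc f y ht
      rw [h, norm_zero] at this
      exact norm_le_zero_iff.mp this
    have := le_max_right 0 (t - s)
    simp only [f] at h1
    linarith

end Cuntz

/-! ### Approximate excision by positive elements of norm one -/

section Excision

variable {D : Type*} [CStarAlgebra D] [PartialOrder D] [StarOrderedRing D]

/-- On `[0, 1]` one has `(1 - t^m)² ≤ 1 - t^m ≤ 1 - t^n`. Hence an element almost fixed by a high
power of `h` is almost fixed by every lower power. -/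
theorem one_sub_pow_sq_le {h : D} (h0 : 0 ≤ h) (h1 : ‖h‖ ≤ 1) {m n : ℕ} (hmn : m ≤ n) :
    (1 - h ^ m) * (1 - h ^ m) ≤ 1 - h ^ n := by
  have hs : IsSelfAdjoint h := .of_nonneg h0
  have e (k : ℕ) : 1 - h ^ k = cfc (fun t : ℝ => 1 - t ^ k) h := by
    rw [cfc_sub _ _ h (by fun_prop) (by fun_prop), cfc_const_one ℝ h, cfc_pow_id h k]
  rw [e m, e n, ← cfc_mul _ _ h (by fun_prop) (by fun_prop)]
  refine cfc_mono fun t ht => ?_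
  have ht0 : 0 ≤ t := spectrum_nonneg_of_nonneg h0 ht
  have ht1 : t ≤ 1 := by
    have := (spectrum.norm_le_norm_mul_of_mem ht)
    rcases subsingleton_or_nontrivial D with hD | hD
    · simp [Subsingleton.elim h 0] at this; linarith
    · simp only [norm_one, mul_one, Real.norm_of_nonneg ht0] at this; linarith
  have h2 : t ^ n ≤ t ^ m := pow_le_pow_of_le_one ht0 ht1 hmn
  have h3 : t ^ m ≤ 1 := pow_le_one₀ ht0 ht1
  have h4 : 0 ≤ t ^ m := pow_nonneg ht0 m
  nlinarith

theorem norm_mul_sq_le {k u c : D} (hk : IsSelfAdjoint k) (hu : IsSelfAdjoint u)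
    (h : u * u ≤ c) : ‖u * k‖ ^ 2 ≤ ‖k * c * k‖ := by
  calc ‖u * k‖ ^ 2 = ‖star (u * k) * (u * k)‖ := by rw [CStarRing.norm_star_mul_self, sq]
    _ = ‖k * (u * u) * k‖ := by rw [star_mul, hk.star_eq, hu.star_eq]; noncomm_ring
    _ ≤ ‖k * c * k‖ := CStarAlgebra.norm_le_norm_of_nonneg_of_le
      (hk.conjugate_nonneg (by simpa [hu.star_eq] using star_mul_self_nonneg u))
      (hk.conjugate_le_conjugate h)

/-- After shifting `b` to `y ≥ 1`, the norms `‖h^{2^k} y h^{2^k}‖` decrease and stay above `1`, so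
two consecutive ones almost agree. An approximate top eigenvector `k` of the later compression must
then be almost fixed by the power of `h`, since otherwise the earlier compression would have larger
norm. Removing the powers of `h` from the eigenvector relation leaves `k y k ≈ μ k²`. -/
theorem exists_nonneg_norm_one_excision [Nontrivial D] {h b : D} (h0 : 0 ≤ h) (h1 : ‖h‖ = 1)
    (hb : IsSelfAdjoint b) {δ : ℝ} (hδ : 0 < δ) :
    ∃ k : D, 0 ≤ k ∧ ‖k‖ = 1 ∧ ‖h * k - k‖ ≤ δ ∧
      ∃ r : ℝ, ‖k * b * k - r • (k * k)‖ ≤ δ := by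
  have hs : IsSelfAdjoint h := .of_nonneg h0
  set C := ‖b‖ + 1 with hC
  set M := 2 * ‖b‖ + 1 with hM
  have hM1 : 1 ≤ M := by simp [hM]
  set y : D := algebraMap ℝ D C + b with hy
  have hy1 : 1 ≤ y := by
    have := hb.neg_algebraMap_norm_le_self
    rw [hy, hC, map_add, map_one]
    calc (1 : D) = algebraMap ℝ D ‖b‖ + 1 + -algebraMap ℝ D ‖b‖ := by abel
      _ ≤ _ := by gcongr
  have hyM : ‖y‖ ≤ M := by
    calc ‖y‖ ≤ ‖algebraMap ℝ D C‖ + ‖b‖ := norm_add_le _ _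
      _ = M := by
        rw [norm_algebraMap', Real.norm_of_nonneg (by positivity), hM, hC]; ring
  have hy0 : 0 ≤ y := zero_le_one.trans hy1
  set lam : ℕ → ℝ := fun k => ‖h ^ 2 ^ k * y * h ^ 2 ^ k‖ with hlam
  have hpow (n : ℕ) : IsSelfAdjoint (h ^ n) := hs.pow n
  have hnorm (k : ℕ) : ‖h ^ 2 ^ k‖ = 1 := by
    have := hs.nnnorm_pow_two_pow k
    have h2 : ‖h‖₊ = 1 := NNReal.eq h1
    rw [h2, one_pow] at this
    exact congrArg NNReal.toReal this
  have hpsq (k : ℕ) : h ^ 2 ^ (k + 1) = h ^ 2 ^ k * h ^ 2 ^ k := by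
    rw [pow_succ 2, mul_two, pow_add]
  have hlam1 (k : ℕ) : 1 ≤ lam k := by
    have : ‖h ^ 2 ^ k * 1 * h ^ 2 ^ k‖ ≤ lam k :=
      CStarAlgebra.norm_le_norm_of_nonneg_of_le ((hpow _).conjugate_nonneg zero_le_one)
        ((hpow _).conjugate_le_conjugate hy1)
    rwa [mul_one, ← hpsq, hnorm] at this
  have hanti : Antitone lam := antitone_nat_of_succ_le fun k => by
    calc lam (k + 1) = ‖h ^ 2 ^ k * (h ^ 2 ^ k * y * h ^ 2 ^ k) * h ^ 2 ^ k‖ := by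
          simp only [hlam, hpsq]; congr 1; noncomm_ring
      _ ≤ ‖h ^ 2 ^ k‖ * ‖h ^ 2 ^ k * y * h ^ 2 ^ k‖ * ‖h ^ 2 ^ k‖ := norm_mul₃_le
      _ = lam k := by rw [hnorm]; ring
  -- The final error is `κ + 4ηM` with `κ ≤ η`. The choice `κ = η²/2` below makes the defect bound
  -- `2κ` equal to `η²`, whose square root is taken to compare `h k` with `k`.
  set η := min 1 (δ / (4 * M + 1)) with hη
  have hη0 : 0 < η := lt_min one_pos (by positivity)
  have hη1 : η ≤ 1 := min_le_left _ _
  have hηδ : η * (4 * M + 1) ≤ δ := by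
    rw [← le_div_iff₀ (by positivity)]; exact min_le_right _ _
  set κ := η ^ 2 / 2 with hκ
  have hκ0 : 0 < κ := by positivity
  obtain ⟨n, hn⟩ : ∃ n, lam n - lam (n + 1) < κ := by
    have hl := tendsto_atTop_ciInf hanti ⟨1, by rintro _ ⟨k, rfl⟩; exact hlam1 k⟩
    have := hl.sub ((tendsto_add_atTop_iff_nat 1).mpr hl)
    rw [sub_self] at this
    exact (this.eventually_lt_const hκ0).exists
  set g := h ^ 2 ^ n with hg
  have hgs : IsSelfAdjoint g := hpow _
  have hgn : ‖g‖ = 1 := hnorm n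
  set x := (g * g) * y * (g * g) with hx
  have hxl : ‖x‖ = lam (n + 1) := by simp only [hlam, hpsq, hx, hg]
  have hggs : IsSelfAdjoint (g * g) := by rw [hg, ← hpsq]; exact hpow _
  have hx0 : 0 ≤ x := hggs.conjugate_nonneg hy0
  obtain ⟨k, hk0, hk1, hk⟩ := exists_nonneg_norm_one_mul_sub_le hx0 hκ0
  have hks : IsSelfAdjoint k := .of_nonneg hk0
  set μ := ‖x‖ with hμ
  have hkx : ‖k * x * k - μ • (k * k)‖ ≤ κ := by
    calc _ = ‖k * (x * k - μ • k)‖ := by rw [mul_sub, mul_smul_comm, mul_assoc]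
      _ ≤ ‖k‖ * ‖x * k - μ • k‖ := norm_mul_le _ _
      _ ≤ κ := by rw [hk1, one_mul]; exact hk
  have hkk : k * k ≤ 1 := by
    have h2 : ‖k * k‖ ≤ 1 := (norm_mul_le _ _).trans (by simp [hk1])
    have := (IsSelfAdjoint.of_nonneg hks.mul_self_nonneg).le_algebraMap_norm_self
    refine this.trans ?_
    rw [← map_one (algebraMap ℝ D)]
    exact algebraMap_mono D h2
  have hc : ‖k * (1 - h ^ 2 ^ (n + 1)) * k‖ ≤ η ^ 2 := by
    have hnn : 0 ≤ k * (1 - h ^ 2 ^ (n + 1)) * k := hks.conjugate_nonneg <|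
      ((IsSelfAdjoint.one D).sub (hpow (2 ^ (n + 1)))).mul_self_nonneg.trans
        (one_sub_pow_sq_le h0 h1.le le_rfl)
    rw [CStarAlgebra.norm_le_iff_le_algebraMap _ (by positivity) hnn]
    -- Here `x = g (g y g) g` and `g y g` is bounded by its norm `lam n`. Against `k x k ≈ μ k²`
    -- with `μ` within `κ` of `lam n`, this forces `k g² k` to be close to `k²`.
    have e1 : k * x * k ≤ lam n • (k * (g * g) * k) := by
      have : g * y * g ≤ algebraMap ℝ D (lam n) :=
        (IsSelfAdjoint.of_nonneg (hgs.conjugate_nonneg hy0)).le_algebraMap_norm_self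
      have := hks.conjugate_le_conjugate (hgs.conjugate_le_conjugate this)
      convert this using 1
      · rw [hx]; noncomm_ring
      · rw [Algebra.algebraMap_eq_smul_one]; simp [mul_assoc]
    have e2 : μ • (k * k) ≤ k * x * k + algebraMap ℝ D κ := by
      have hsa : IsSelfAdjoint (k * x * k - μ • (k * k)) :=
        (IsSelfAdjoint.of_nonneg (hks.conjugate_nonneg hx0)).sub
          (.smul (.all μ) (.of_nonneg hks.mul_self_nonneg))
      have h5 := hsa.neg_algebraMap_norm_le_self
      have h6 := algebraMap_mono D hkx
      have := sub_nonneg.mpr h5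
      have h7 := sub_nonneg.mpr h6
      rw [← sub_nonneg]
      convert add_nonneg this h7 using 1
      abel
    have hl0 : 0 < lam n := zero_lt_one.trans_le (hlam1 n)
    have e3 : lam n • (k * (1 - h ^ 2 ^ (n + 1)) * k) ≤ algebraMap ℝ D (2 * κ) := by
      have e4 : lam n • (k * (1 - h ^ 2 ^ (n + 1)) * k) =
          (lam n - μ) • (k * k) + (μ • (k * k) - lam n • (k * (g * g) * k)) := by
        rw [hpsq, mul_sub, sub_mul, mul_one, smul_sub, sub_smul]; abel
      have e5 : (lam n - μ) • (k * k) ≤ κ • (1 : D) :=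
        calc (lam n - μ) • (k * k) ≤ (lam n - μ) • (1 : D) :=
              smul_le_smul_of_nonneg_left hkk (by rw [hxl]; linarith [hanti n.le_succ])
          _ ≤ κ • (1 : D) := by
            refine smul_le_smul_of_nonneg_right ?_ zero_le_one
            rw [hxl]; exact hn.le
      have e6 : μ • (k * k) - lam n • (k * (g * g) * k) ≤ algebraMap ℝ D κ := by
        rw [sub_le_iff_le_add']
        exact e2.trans (by gcongr)
      rw [e4, two_mul, map_add]
      refine add_le_add ?_ e6
      rwa [Algebra.algebraMap_eq_smul_one]
    calc _ = (1 : ℝ) • (k * (1 - h ^ 2 ^ (n + 1)) * k) := (one_smul _ _).symm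
      _ ≤ lam n • (k * (1 - h ^ 2 ^ (n + 1)) * k) :=
        smul_le_smul_of_nonneg_right (hlam1 n) hnn
      _ ≤ _ := by convert e3 using 2; rw [hκ]; ring
  have hhk : ‖h * k - k‖ ≤ η := by
    have := norm_mul_sq_le hks ((IsSelfAdjoint.one D).sub (hpow 1))
      (one_sub_pow_sq_le h0 h1.le (Nat.one_le_two_pow (n := n + 1)))
    rw [pow_one] at this
    have h3 := abs_le_of_sq_le_sq (this.trans hc) hη0.le
    rw [← norm_neg, show ∀ u : D, -(u * k - k) = (1 - u) * k by intro u; noncomm_ring]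
    exact (le_abs_self _).trans h3
  have hgk : ‖g * k - k‖ ≤ η := by
    have := norm_mul_sq_le hks ((IsSelfAdjoint.one D).sub (hpow (2 ^ n)))
      (one_sub_pow_sq_le h0 h1.le (Nat.pow_le_pow_right two_pos n.le_succ))
    have h3 := abs_le_of_sq_le_sq (this.trans hc) hη0.le
    rw [← norm_neg, show ∀ u : D, -(u * k - k) = (1 - u) * k by intro u; noncomm_ring]
    exact (le_abs_self _).trans h3
  have hggk : ‖g * g * k - k‖ ≤ 2 * η := by
    calc _ = ‖g * (g * k - k) + (g * k - k)‖ := by congr 1; noncomm_ring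
      _ ≤ ‖g‖ * ‖g * k - k‖ + ‖g * k - k‖ :=
        (norm_add_le _ _).trans (by gcongr; exact norm_mul_le _ _)
      _ ≤ 2 * η := by rw [hgn]; linarith
  have hggk' : ‖k * (g * g) - k‖ ≤ 2 * η := by
    rw [← norm_star]
    simpa [star_sub, star_mul, hks.star_eq, hgs.star_eq, mul_assoc] using hggk
  -- Subtracting `C` undoes the shift from `b` to `y`.
  refine ⟨k, hk0, hk1, hhk.trans ?_, μ - C, ?_⟩
  · nlinarith
  have e7 : k * b * k - (μ - C) • (k * k) = (k * x * k - μ • (k * k))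
      - (k * (g * g) - k) * y * (g * g * k) - k * y * (g * g * k - k) := by
    rw [hx, hy, Algebra.algebraMap_eq_smul_one, sub_smul]
    simp only [mul_add, add_mul, sub_mul, mul_sub, smul_mul_assoc, mul_smul_comm, mul_one,
      mul_assoc, smul_sub]
    abel
  have hggn : ‖g * g * k‖ ≤ 1 := by
    refine norm_mul₃_le.trans ?_
    rw [hgn, hk1]; norm_num
  rw [e7]
  calc _ ≤ ‖k * x * k - μ • (k * k)‖ + ‖(k * (g * g) - k) * y * (g * g * k)‖
        + ‖k * y * (g * g * k - k)‖ :=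
        (norm_sub_le _ _).trans (by gcongr; exact norm_sub_le _ _)
    _ ≤ κ + 2 * η * M * 1 + 1 * M * (2 * η) := by
        gcongr
        · exact norm_mul₃_le.trans (by gcongr)
        · exact norm_mul₃_le.trans (by rw [hk1]; gcongr)
    _ ≤ δ := by nlinarith

/-- Excision is inherited: if `k` excises `c` and `k m ≈ m`, then `m c m ≈ m (k c k) m ≈ r m k² m ≈
r m²`. So the elements can be treated one at a time, each new `m` being chosen almost fixed by the
previous `k`. -/
theorem exists_nonneg_norm_one_excision_list [Nontrivial D] {h : D} (h0 : 0 ≤ h) (h1 : ‖h‖ = 1)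
    (l : List D) (hl : ∀ b ∈ l, IsSelfAdjoint b) {δ : ℝ} (hδ : 0 < δ) :
    ∃ k : D, 0 ≤ k ∧ ‖k‖ = 1 ∧ ‖h * k - k‖ ≤ δ ∧
      ∀ b ∈ l, ∃ r : ℝ, ‖k * b * k - r • (k * k)‖ ≤ δ := by
  induction l generalizing δ with
  | nil =>
    obtain ⟨k, hk0, hk1, hk, -⟩ := exists_nonneg_norm_one_excision h0 h1 (.zero D) hδ
    exact ⟨k, hk0, hk1, hk, by simp⟩
  | cons b l ih =>
    obtain ⟨k, hk0, hk1, hhk, hk⟩ := ih (fun b hb => hl b (List.mem_cons_of_mem _ hb))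
      (half_pos hδ)
    choose! r hr using hk
    -- Replacing `k m` by `m` costs at most `2η(‖c‖ + |r c|)`, so `η` is chosen after a common bound
    -- `R` for the elements already treated.
    obtain ⟨R, hR⟩ : ∃ R, ∀ b ∈ l, ‖b‖ + |r b| ≤ R := by
      obtain ⟨R, hR⟩ := (l.finite_toSet.image fun b => ‖b‖ + |r b|).bddAbove
      exact ⟨R, fun b hb => hR ⟨b, hb, rfl⟩⟩
    set η := min (δ / 4) (δ / (4 * (|R| + 1))) with hη
    have hη0 : 0 < η := lt_min (by positivity) (by positivity)
    have hη1 : η ≤ δ / 4 := min_le_left _ _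
    have hηR : η * (4 * (|R| + 1)) ≤ δ := by
      rw [← le_div_iff₀ (by positivity)]; exact min_le_right _ _
    obtain ⟨m, hm0, hm1, hkm, s, hs⟩ :=
      exists_nonneg_norm_one_excision hk0 hk1 (hl b List.mem_cons_self) hη0
    have hms : IsSelfAdjoint m := .of_nonneg hm0
    have hks : IsSelfAdjoint k := .of_nonneg hk0
    have hhn : ‖h * k * m - k * m‖ ≤ δ / 2 := by
      rw [← sub_mul]
      exact (norm_mul_le _ _).trans (by rw [hm1, mul_one]; exact hhk)
    have hmk : ‖m * k - m‖ ≤ η := by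
      rw [← norm_star]
      simpa [star_sub, star_mul, hms.star_eq, hks.star_eq] using hkm
    have hkmn : ‖k * m‖ ≤ 1 := (norm_mul_le _ _).trans (by simp [hk1, hm1])
    refine ⟨m, hm0, hm1, ?_, ?_⟩
    · have : h * m - m = (h * k * m - k * m) + (k * m - m) - h * (k * m - m) := by noncomm_ring
      rw [this]
      calc _ ≤ ‖h * k * m - k * m‖ + ‖k * m - m‖ + ‖h‖ * ‖k * m - m‖ :=
            (norm_sub_le _ _).trans (add_le_add (norm_add_le _ _) (norm_mul_le _ _))
        _ ≤ δ := by rw [h1]; linarith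
    · intro c hc
      rcases List.mem_cons.mp hc with rfl | hc
      · exact ⟨s, hs.trans (by linarith)⟩
      refine ⟨r c, ?_⟩
      have e : m * c * m - r c • (m * m) = m * (k * c * k - r c • (k * k)) * m
          - ((m * k - m) * c * (k * m) + m * c * (k * m - m))
          + r c • ((m * k - m) * (k * m) + m * (k * m - m)) := by
        simp only [sub_mul, mul_sub, smul_mul_assoc, mul_smul_comm, mul_assoc,
          smul_add, smul_sub]
        abel
      rw [e]
      calc _ ≤ ‖m * (k * c * k - r c • (k * k)) * m‖
            + (‖(m * k - m) * c * (k * m)‖ + ‖m * c * (k * m - m)‖)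
            + |r c| * (‖(m * k - m) * (k * m)‖ + ‖m * (k * m - m)‖) := by
            refine (norm_add_le _ _).trans (add_le_add ((norm_sub_le _ _).trans ?_) ?_)
            · gcongr; exact norm_add_le _ _
            · rw [norm_smul, Real.norm_eq_abs]; gcongr; exact norm_add_le _ _
        _ ≤ 1 * (δ / 2) * 1 + (η * ‖c‖ * 1 + 1 * ‖c‖ * η) + |r c| * (η * 1 + 1 * η) := by
            gcongr
            · exact norm_mul₃_le.trans (by rw [hm1]; gcongr; exact hr c hc)
            · exact norm_mul₃_le.trans (by gcongr)
            · exact norm_mul₃_le.trans (by rw [hm1]; gcongr)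
            · exact (norm_mul_le _ _).trans (by gcongr)
            · exact (norm_mul_le _ _).trans (by rw [hm1]; gcongr)
        _ = δ / 2 + 2 * η * (‖c‖ + |r c|) := by ring
        _ ≤ δ := by nlinarith [hR c hc, le_abs_self R]

end Excision

/-! ### Simple C*-algebras and minimal projections -/

section Simple

variable {D : Type*} [CStarAlgebra D]

theorem IsSelfAdjoint.eq_zero_of_mul_self_eq_zero {x : D} (hx : IsSelfAdjoint x)
    (h : x * x = 0) : x = 0 := by
  rw [← CStarRing.star_mul_self_eq_zero_iff, hx.star_eq, h]

/-- The closure of the algebraic ideal generated by `x` contains `1`, so the ideal itself contains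
an element at distance less than one from `1`. Such an element is invertible. -/
theorem IsSimpleCStar.exists_sum_mul_mul_eq_one (hD : IsSimpleCStar D) {x : D} (hx : x ≠ 0) :
    ∃ (ι : Type) (_ : Fintype ι) (y w : ι → D), ∑ i, y i * x * w i = 1 := by
  let S : Set D := {s | ∃ (ι : Type) (_ : Fintype ι) (y w : ι → D), ∑ i, y i * x * w i = s}
  have hS0 : (0 : D) ∈ S := ⟨Empty, inferInstance, 0, 0, by simp⟩
  have hSadd {a b : D} (ha : a ∈ S) (hb : b ∈ S) : a + b ∈ S := by
    obtain ⟨ι, _, y, w, rfl⟩ := ha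
    obtain ⟨κ, _, y', w', rfl⟩ := hb
    exact ⟨ι ⊕ κ, inferInstance, Sum.elim y y', Sum.elim w w', by simp⟩
  have hSl (c : D) {a : D} (ha : a ∈ S) : c * a ∈ S := by
    obtain ⟨ι, _, y, w, rfl⟩ := ha
    exact ⟨ι, inferInstance, fun i => c * y i, w, by simp [Finset.mul_sum, mul_assoc]⟩
  have hSr (c : D) {a : D} (ha : a ∈ S) : a * c ∈ S := by
    obtain ⟨ι, _, y, w, rfl⟩ := ha
    exact ⟨ι, inferInstance, y, fun i => w i * c, by simp [Finset.sum_mul, mul_assoc]⟩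
  let I : TwoSidedIdeal D := TwoSidedIdeal.mk' (closure S) (subset_closure hS0)
    (fun ha hb => map_mem_closure₂ continuous_add ha hb fun _ ha _ hb => hSadd ha hb)
    (fun ha => map_mem_closure continuous_neg ha fun a ha => by simpa using hSl (-1) ha)
    (fun {c _} ha => map_mem_closure (continuous_const_mul c) ha fun _ ha => hSl c ha)
    (fun {_ c} ha => map_mem_closure (f := (· * c)) (continuous_mul_const c) ha
      fun _ ha => hSr c ha)
  have hI : (I : Set D) = closure S := TwoSidedIdeal.coe_mk' ..
  have hxI : x ∈ I := by
    rw [← SetLike.mem_coe, hI]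
    exact subset_closure ⟨Unit, inferInstance, 1, 1, by simp⟩
  have h1 : (1 : D) ∈ closure S := by
    rcases hD.2 I (hI ▸ isClosed_closure) with h | h
    · rw [h, TwoSidedIdeal.mem_bot] at hxI; exact absurd hxI hx
    · rw [← hI, h]; exact TwoSidedIdeal.mem_top D
  obtain ⟨s, hs, hs1⟩ := Metric.mem_closure_iff.mp h1 1 one_pos
  rw [dist_eq_norm] at hs1
  have hu := isUnit_one_sub_of_norm_lt_one hs1
  rw [sub_sub_cancel] at hu
  obtain ⟨u, rfl⟩ := hu
  have := hSl (↑u⁻¹) hs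
  rwa [Units.inv_mul] at this

theorem IsSimpleCStar.exists_mul_mul_ne_zero (hD : IsSimpleCStar D) {p q : D} (hp : p ≠ 0)
    (hq : q ≠ 0) : ∃ x, p * x * q ≠ 0 := by
  by_contra! h
  obtain ⟨ι, _, y, w, h1⟩ := hD.exists_sum_mul_mul_eq_one hq
  refine hp ?_
  rw [← mul_one p, ← h1, Finset.mul_sum]
  exact Finset.sum_eq_zero fun i _ => by rw [← mul_assoc, ← mul_assoc, h, zero_mul]

/-- If the spectrum had at most one nonzero point `t`, then `x² = t x`. With two such points, tent
functions of half-width `|s - t| / 2` around them have product zero, and neither kills `x`. -/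
theorem exists_orthogonal_of_mul_self_ne_smul {x : D} (hx : IsSelfAdjoint x)
    (h : ∀ t : ℝ, x * x ≠ t • x) :
    ∃ f g : D, IsSelfAdjoint f ∧ IsSelfAdjoint g ∧ Commute f x ∧ Commute g x ∧ f * g = 0 ∧
      f * x ≠ 0 ∧ g * x ≠ 0 := by
  obtain ⟨s, hs, hs0, t, ht, ht0, hst⟩ : ∃ s ∈ spectrum ℝ x, s ≠ 0 ∧ ∃ t ∈ spectrum ℝ x,
      t ≠ 0 ∧ s ≠ t := by
    by_contra! H
    obtain ⟨t, ht⟩ : ∃ t : ℝ, ∀ s ∈ spectrum ℝ x, s = 0 ∨ s = t := by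
      by_cases h0 : ∃ t ∈ spectrum ℝ x, t ≠ 0
      · obtain ⟨t, ht, ht0⟩ := h0
        exact ⟨t, fun s hs => or_iff_not_imp_left.mpr fun hs0 => H s hs hs0 t ht ht0⟩
      · push Not at h0
        exact ⟨0, fun s hs => Or.inl (h0 s hs)⟩
    refine h t ?_
    calc x * x = cfc (fun r : ℝ => r * r) x := by
          rw [cfc_mul (fun r : ℝ => r) (fun r => r) x, cfc_id' ℝ x]
      _ = cfc (fun r : ℝ => t * r) x := cfc_congr fun r hr => by
          rcases ht r hr with rfl | rfl <;> simp
      _ = t • x := by rw [cfc_const_mul t (fun r => r) x, cfc_id' ℝ x]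
  let F : ℝ → ℝ → ℝ := fun a r => max 0 (|s - t| / 2 - |r - a|)
  have hF (a : ℝ) : Continuous (F a) := by fun_prop
  have hne (a : ℝ) (ha : a ∈ spectrum ℝ x) (ha0 : a ≠ 0) : cfc (F a) x * x ≠ 0 := by
    intro h0
    have h1 : cfc (F a) x * x = cfc (fun r => F a r * r) x := by
      rw [cfc_mul (F a) (fun r => r) x (by fun_prop) (by fun_prop), cfc_id' ℝ x]
    have h2 := norm_apply_le_norm_cfc (fun r => F a r * r) x ha
    rw [← h1, h0, norm_zero, norm_le_zero_iff] at h2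
    have : 0 < |s - t| := abs_pos.mpr (sub_ne_zero.mpr hst)
    have h3 : F a a = |s - t| / 2 := by simp [F]; positivity
    simp only [h3] at h2
    rcases mul_eq_zero.mp h2 with h4 | h4
    · linarith
    · exact ha0 h4
  have hcomm (a : ℝ) : Commute (cfc (F a) x) x := by
    simpa only [cfc_id' ℝ x] using cfc_commute_cfc (F a) (fun r => r) x
  refine ⟨cfc (F s) x, cfc (F t) x, cfc_predicate _ _, cfc_predicate _ _, hcomm s, hcomm t, ?_,
    hne s hs hs0, hne t ht ht0⟩
  rw [← cfc_mul (F s) (F t) x (by fun_prop) (by fun_prop), ← cfc_zero ℝ x]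
  refine cfc_congr fun r _ => ?_
  have h1 := abs_sub_le s r t
  rw [abs_sub_comm s r] at h1
  rcases le_total (|s - t| / 2) |r - s| with h2 | h2
  · simp [F, h2]
  · have : |s - t| / 2 ≤ |r - t| := by linarith
    simp [F, this]

/-- A nonzero projection `p` whose corner `p D p` is one-dimensional. -/
def IsMinimalProjection (p : D) : Prop :=
  p ≠ 0 ∧ IsStarProjection p ∧ ∀ b : D, ∃ c : ℂ, p * b * p = c • p

theorem IsMinimalProjection.of_forall_isSelfAdjoint {p : D} (hp0 : p ≠ 0)
    (hp : IsStarProjection p) (h : ∀ b : D, IsSelfAdjoint b → ∃ c : ℝ, p * b * p = c • p) :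
    IsMinimalProjection p := by
  refine ⟨hp0, hp, fun b => ?_⟩
  obtain ⟨c, hc⟩ := h (realPart b : D) (realPart b).2
  obtain ⟨d, hd⟩ := h (imaginaryPart b : D) (imaginaryPart b).2
  refine ⟨c + Complex.I * d, ?_⟩
  rw [← realPart_add_I_smul_imaginaryPart b]
  simp only [mul_add, add_mul, mul_smul_comm, smul_mul_assoc, hc, hd]
  have e (r : ℝ) : r • p = (r : ℂ) • p := (Complex.coe_smul r p).symm
  rw [e, e, smul_smul, ← add_smul]

variable [PartialOrder D] [StarOrderedRing D]

/-- Add `1 = ∑ y i * b * w i` to its adjoint and expand the positivity of `(y i - star (w i)) * b *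
star (y i - star (w i))`. The cross terms are dominated by the diagonal ones, which therefore sum to
at least `2`. -/
theorem IsSimpleCStar.exists_one_le_sum_conj (hD : IsSimpleCStar D) {b : D} (hb : 0 ≤ b)
    (hb0 : b ≠ 0) :
    ∃ (ι : Type) (_ : Fintype ι) (c : ι → D), 1 ≤ ∑ i, c i * b * star (c i) := by
  obtain ⟨ι, _, y, w, h1⟩ := hD.exists_sum_mul_mul_eq_one hb0
  refine ⟨ι ⊕ ι, inferInstance, Sum.elim y fun i => star (w i), ?_⟩
  have hbs : star b = b := (IsSelfAdjoint.of_nonneg hb).star_eq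
  have h2 : ∑ i, star (w i) * b * star (y i) = 1 := by
    have := congrArg star h1
    simpa [star_sum, star_mul, hbs, mul_assoc] using this
  have h3 : (1 : D) ≤ 1 + 1 := le_add_of_nonneg_right zero_le_one
  refine h3.trans ?_
  nth_rw 1 [← h1]
  rw [← h2, Fintype.sum_sum_type, ← sub_nonneg]
  simp only [Sum.elim_inl, Sum.elim_inr, star_star, ← Finset.sum_add_distrib,
    ← Finset.sum_sub_distrib]
  refine Finset.sum_nonneg fun i _ => ?_
  have := star_right_conjugate_nonneg hb (y i - star (w i))
  rw [star_sub, star_star] at this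
  convert this using 1
  noncomm_ring

/-- The hypothesis forbids splitting `a` into two orthogonal nonzero pieces. Used with functions of
`a`, it makes `a` a scalar multiple of a projection `p`; used with functions of a self-adjoint `c =
p b p`, it gives `c² = s c`. The same relation for `c + M p` turns this quadratic relation into a
linear one, making `c` a multiple of `p`. -/
theorem exists_isMinimalProjection_of_forall {a : D} (ha : 0 ≤ a) (ha0 : a ≠ 0)
    (h : ∀ f g : D, f * a * star g = 0 → f * a * star f = 0 ∨ g * a * star g = 0) :
    ∃ p : D, IsMinimalProjection p := by
  have has : IsSelfAdjoint a := .of_nonneg ha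
  obtain ⟨t, ht⟩ : ∃ t : ℝ, a * a = t • a := by
    by_contra! H
    obtain ⟨f, g, hf, hg, hfa, hga, hfg, hf0, hg0⟩ := exists_orthogonal_of_mul_self_ne_smul has H
    have key {f : D} (hf : IsSelfAdjoint f) (hfa : Commute f a) (h0 : f * a * star f = 0) :
        f * a = 0 := by
      refine ((hf.commute_iff has).mp hfa).eq_zero_of_mul_self_eq_zero ?_
      rw [← mul_assoc, show f * a * f = 0 by rwa [hf.star_eq] at h0, zero_mul]
    rcases h f g (by rw [hg.star_eq, hfa.eq, mul_assoc, hfg, mul_zero]) with h0 | h0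
    · exact hf0 (key hf hfa h0)
    · exact hg0 (key hg hga h0)
  have ht0 : t ≠ 0 := by
    rintro rfl
    rw [zero_smul] at ht
    exact ha0 (has.eq_zero_of_mul_self_eq_zero ht)
  obtain ⟨p, hp⟩ : ∃ p, p = t⁻¹ • a := ⟨_, rfl⟩
  have hap : a = t • p := by rw [hp, smul_smul, mul_inv_cancel₀ ht0, one_smul]
  have hpp : p * p = p := by
    rw [hp, smul_mul_smul_comm, ht, smul_smul]; congr 1; field_simp
  have hps : IsSelfAdjoint p := hp ▸ .smul (.all _) has
  have hp0 : p ≠ 0 := hp ▸ smul_ne_zero (inv_ne_zero ht0) ha0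
  have hcorner (b : D) (hb : IsSelfAdjoint b) :
      ∃ s : ℝ, (p * b * p) * (p * b * p) = s • (p * b * p) := by
    by_contra! H
    set c := p * b * p with hc
    have hcs : IsSelfAdjoint c := by simpa [hps.star_eq] using hb.conjugate p
    obtain ⟨f, g, hf, hg, hfc, hgc, hfg, hf0, hg0⟩ := exists_orthogonal_of_mul_self_ne_smul hcs H
    have hcp : c * p = c := by rw [hc, mul_assoc, hpp]
    have e (u v : D) (hv : IsSelfAdjoint v) (hvc : Commute v c) :
        u * c * a * star (v * c) = t • (u * c * (v * c)) := by
      rw [((hv.commute_iff hcs).mp hvc).star_eq, hap, mul_smul_comm, smul_mul_assoc,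
        hvc.eq, mul_assoc u c p, hcp]
    have key {f : D} (hf : IsSelfAdjoint f) (hfc : Commute f c)
        (h0 : f * c * a * star (f * c) = 0) : f * c = 0 := by
      rw [e f f hf hfc, smul_eq_zero] at h0
      exact ((hf.commute_iff hcs).mp hfc).eq_zero_of_mul_self_eq_zero (h0.resolve_left ht0)
    rcases h (f * c) (g * c) (by
      rw [e f g hg hgc, hfc.eq, mul_assoc c f, ← mul_assoc f g, hfg, zero_mul, mul_zero,
        smul_zero]) with h0 | h0
    · exact hf0 (key hf hfc h0)
    · exact hg0 (key hg hgc h0)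
  refine ⟨p, .of_forall_isSelfAdjoint hp0 ⟨hpp, hps⟩ fun b hb => ?_⟩
  obtain ⟨s, hs⟩ := hcorner b hb
  -- If the coefficient `s + 2M - s'` of `c` in the linear relation vanished, then `M (s + M) = 0`.
  -- This choice makes both factors positive.
  set M := |s| + 1 with hM
  obtain ⟨s', hs'⟩ := hcorner (b + algebraMap ℝ D M) (hb.add (.algebraMap D (.all M)))
  have hc' : p * (b + algebraMap ℝ D M) * p = p * b * p + M • p := by
    rw [mul_add, add_mul, Algebra.algebraMap_eq_smul_one, mul_smul_comm, mul_one, smul_mul_assoc,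
      hpp]
  rw [hc'] at hs'
  set c := p * b * p with hc
  have hcp : c * p = c := by rw [hc, mul_assoc, hpp]
  have hpc : p * c = c := by rw [hc, ← mul_assoc, ← mul_assoc, hpp]
  have h1 : (s + 2 * M - s') • c = (s' * M - M * M) • p := by
    simp only [mul_add, add_mul, smul_mul_assoc, mul_smul_comm, hs, hcp, hpc, hpp, smul_add,
      smul_smul] at hs'
    rw [← sub_eq_zero] at hs' ⊢
    rw [← hs']
    module
  by_cases h2 : s + 2 * M - s' = 0
  · rw [h2, zero_smul, eq_comm, smul_eq_zero] at h1
    have h3 := h1.resolve_right hp0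
    have h4 : M * (s + M) = 0 := by linear_combination h3 + M * h2
    have := neg_abs_le s
    rcases mul_eq_zero.mp h4 with h5 | h5
    · have := abs_nonneg s; linarith
    · linarith
  · exact ⟨(s + 2 * M - s')⁻¹ * (s' * M - M * M), by
      rw [mul_smul, ← h1, smul_smul, inv_mul_cancel₀ h2, one_smul]⟩

/-- Without minimal projections, `a` has two orthogonal nonzero pieces `P = f a f*` and `Q = g a
g*`, and primeness gives `x` with `P x Q ≠ 0`. Put `N = P^{1/2} x Q x* P^{1/2}`. Then `N²` is a
conjugate of `P` by `P^{1/2} x Q x*` and of `Q` by `N^{1/2} P^{1/2} x`, so both pieces are moved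
onto the same element while their orthogonality persists. -/
theorem IsSimpleCStar.exists_orthogonal_conj_eq (hD : IsSimpleCStar D)
    (hmin : ∀ p : D, ¬ IsMinimalProjection p) {a : D} (ha : 0 ≤ a) (ha0 : a ≠ 0) :
    ∃ d e a' : D, 0 ≤ a' ∧ a' ≠ 0 ∧ d * a * star d = a' ∧ e * a * star e = a' ∧
      d * a * star e = 0 ∧ e * a * star d = 0 := by
  obtain ⟨f, g, hfg, hf, hg⟩ : ∃ f g : D, f * a * star g = 0 ∧ f * a * star f ≠ 0 ∧
      g * a * star g ≠ 0 := by
    by_contra! H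
    obtain ⟨p, hp⟩ := exists_isMinimalProjection_of_forall ha ha0 fun f g h =>
      or_iff_not_imp_left.mpr (H f g h)
    exact hmin p hp
  have has : star a = a := (IsSelfAdjoint.of_nonneg ha).star_eq
  set P := f * a * star f with hP
  set Q := g * a * star g with hQ
  have hP0 : 0 ≤ P := star_right_conjugate_nonneg ha f
  have hQ0 : 0 ≤ Q := star_right_conjugate_nonneg ha g
  obtain ⟨x, hx⟩ := hD.exists_mul_mul_ne_zero hf hg
  set p := CFC.sqrt P with hp
  have hpp : p * p = P := CFC.sqrt_mul_sqrt_self P hP0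
  have hps : star p = p := (IsSelfAdjoint.of_nonneg (CFC.sqrt_nonneg P)).star_eq
  set q := CFC.sqrt Q with hq
  have hqq : q * q = Q := CFC.sqrt_mul_sqrt_self Q hQ0
  have hqs : star q = q := (IsSelfAdjoint.of_nonneg (CFC.sqrt_nonneg Q)).star_eq
  have hQs : star Q = Q := (IsSelfAdjoint.of_nonneg hQ0).star_eq
  set N := p * x * Q * star (p * x) with hN
  have hN0 : 0 ≤ N := star_right_conjugate_nonneg hQ0 _
  have hNs : star N = N := (IsSelfAdjoint.of_nonneg hN0).star_eq
  set n := CFC.sqrt N with hn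
  have hnn : n * n = N := CFC.sqrt_mul_sqrt_self N hN0
  have hns : star n = n := (IsSelfAdjoint.of_nonneg (CFC.sqrt_nonneg N)).star_eq
  have hN1 : N ≠ 0 := by
    intro h0
    have h1 : p * x * q = 0 := by
      rw [← CStarRing.mul_star_self_eq_zero_iff, ← h0, hN, star_mul, hqs, ← hqq]
      noncomm_ring
    refine hx ?_
    rw [← hpp, ← hqq]
    calc p * p * x * (q * q) = p * (p * x * q) * q := by noncomm_ring
      _ = 0 := by rw [h1]; simp
  have hgf : g * a * star f = 0 := by
    have := congrArg star hfg
    simpa [star_mul, has, mul_assoc] using this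
  refine ⟨p * x * Q * star x * f, n * p * x * g, N * N, ?_, ?_, ?_, ?_, ?_, ?_⟩
  · simpa [hNs] using star_mul_self_nonneg N
  · intro h0
    refine hN1 ?_
    rw [← CStarRing.star_mul_self_eq_zero_iff, hNs, h0]
  · calc _ = p * x * Q * star x * (f * a * star f) * x * Q * star x * p := by
          simp only [star_mul, star_star, hps, hQs]; noncomm_ring
      _ = (p * x * Q * (star x * p)) * (p * x * Q * (star x * p)) := by
          rw [← hP, ← hpp]; noncomm_ring
      _ = _ := by rw [hN, star_mul, hps]
  · calc _ = n * (p * x * (g * a * star g) * (star x * p)) * n := by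
          simp only [star_mul, hps, hns]; noncomm_ring
      _ = n * (n * n) * n := by rw [hnn, ← hQ, hN, star_mul, hps]
      _ = _ := by rw [← hnn]; noncomm_ring
  · calc _ = p * x * Q * star x * (f * a * star g) * star (n * p * x) := by
          simp only [star_mul]; noncomm_ring
      _ = 0 := by rw [hfg]; simp
  · calc _ = n * p * x * (g * a * star f) * star (p * x * Q * star x) := by
          simp only [star_mul]; noncomm_ring
      _ = 0 := by rw [hgf]; simp

/-- Iterating the splitting of `a` into two equivalent orthogonal pieces doubles the family at each
step; a large enough family is then restricted to `ι`. -/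
theorem IsSimpleCStar.exists_orthogonal_family_conj_eq (hD : IsSimpleCStar D)
    (hmin : ∀ p : D, ¬ IsMinimalProjection p) {a : D} (ha : 0 ≤ a) (ha0 : a ≠ 0)
    (ι : Type) [Fintype ι] [DecidableEq ι] :
    ∃ (d : ι → D) (a' : D), 0 ≤ a' ∧ a' ≠ 0 ∧
      ∀ i j, d i * a * star (d j) = if i = j then a' else 0 := by
  -- The strict inequality keeps `κ` nonempty, so that doubling really increases its size in the
  -- inductive step.
  obtain ⟨κ, _, _, hκ, d, a', ha', ha'0, h⟩ : ∃ (κ : Type) (_ : Fintype κ) (_ : DecidableEq κ),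
      Fintype.card ι < Fintype.card κ ∧ ∃ (d : κ → D) (a' : D), 0 ≤ a' ∧ a' ≠ 0 ∧
        ∀ i j, d i * a * star (d j) = if i = j then a' else 0 := by
    generalize Fintype.card ι = n
    induction n with
    | zero => exact ⟨Unit, inferInstance, inferInstance, by simp, 1, a, ha, ha0, by simp⟩
    | succ n ih =>
      obtain ⟨κ, _, _, hκ, d, a', ha', ha'0, h⟩ := ih
      obtain ⟨e, f, b, hb, hb0, hee, hff, hef, hfe⟩ :=
        hD.exists_orthogonal_conj_eq hmin ha' ha'0
      refine ⟨κ ⊕ κ, inferInstance, inferInstance, ?_,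
        Sum.elim (fun i => e * d i) (fun i => f * d i), b, hb, hb0, ?_⟩
      · rw [Fintype.card_sum]; omega
      · have key (u v : D) (i j : κ) : u * d i * a * star (v * d j) =
            if i = j then u * a' * star v else 0 := by
          calc _ = u * (d i * a * star (d j)) * star v := by rw [star_mul]; noncomm_ring
            _ = _ := by rw [h]; split_ifs <;> simp
        rintro (i | i) (j | j) <;> simp only [Sum.elim_inl, Sum.elim_inr, key] <;>
          simp [hee, hff, hef, hfe]
  obtain ⟨φ⟩ := Function.Embedding.nonempty_of_card_le hκ.le
  exact ⟨d ∘ φ, a', ha', ha'0, fun i j => by simp [h]⟩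

end Simple

/-! ### Elementary tensors and their density -/

namespace MinTensor

section Basic

variable {A : Type u} {B : Type v} [CStarAlgebra A] [CStarAlgebra B]

variable (A B) in
/-- The canonical `*`-homomorphism from the algebraic to the minimal tensor product. -/
noncomputable def ofAlgebraic : A ⊗[ℂ] B →⋆ₐ[ℂ] MinTensor A B :=
  (toRepProd A B).codRestrict (toRepProd A B).range.topologicalClosure
    fun x => StarSubalgebra.le_topologicalClosure _ ⟨x, rfl⟩

theorem ofAlgebraic_tmul (a : A) (b : B) : ofAlgebraic A B (a ⊗ₜ b) = tmul a b := rfl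

theorem denseRange_ofAlgebraic : DenseRange (ofAlgebraic A B) := by
  intro x
  rw [Metric.mem_closure_iff]
  intro ε hε
  obtain ⟨_, ⟨t, rfl⟩, ht⟩ := Metric.mem_closure_iff.mp
    (show (x.1 : RepProd A B) ∈ closure ((toRepProd A B).range : Set (RepProd A B)) from x.2) ε hε
  exact ⟨_, ⟨t, rfl⟩, ht⟩

theorem tmul_mul_tmul (a a' : A) (b b' : B) :
    tmul a b * tmul a' b' = tmul (a * a') (b * b') := by
  simp only [← ofAlgebraic_tmul, ← map_mul, Algebra.TensorProduct.tmul_mul_tmul]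

theorem star_tmul (a : A) (b : B) : star (tmul a b) = tmul (star a) (star b) := by
  rw [← ofAlgebraic_tmul, ← map_star, TensorProduct.star_tmul, ofAlgebraic_tmul]

variable (A B) in
/-- The map `(a, b) ↦ a ⊗ b` as a bilinear map. -/
noncomputable def tmulBilin : A →ₗ[ℂ] B →ₗ[ℂ] MinTensor A B :=
  (TensorProduct.mk ℂ A B).compr₂ (ofAlgebraic A B).toLinearMap

theorem tmulBilin_apply (a : A) (b : B) : tmulBilin A B a b = tmul a b := rfl

theorem add_tmul (a a' : A) (b : B) : tmul (a + a') b = tmul a b + tmul a' b := by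
  simp [← tmulBilin_apply]

theorem sub_tmul (a a' : A) (b : B) : tmul (a - a') b = tmul a b - tmul a' b := by
  simp [← tmulBilin_apply]

theorem tmul_sub (a : A) (b b' : B) : tmul a (b - b') = tmul a b - tmul a b' := by
  simp [← tmulBilin_apply]

theorem smul_tmul (c : ℂ) (a : A) (b : B) : tmul (c • a) b = c • tmul a b := by
  simp [← tmulBilin_apply]

theorem tmul_smul (c : ℂ) (a : A) (b : B) : tmul a (c • b) = c • tmul a b := by
  simp [← tmulBilin_apply]

theorem smul_tmul_real (c : ℝ) (a : A) (b : B) : tmul (c • a) b = c • tmul a b := by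
  rw [← Complex.coe_smul, smul_tmul, Complex.coe_smul]

theorem tmul_smul_real (c : ℝ) (a : A) (b : B) : tmul a (c • b) = c • tmul a b := by
  rw [← Complex.coe_smul, tmul_smul, Complex.coe_smul]

theorem zero_tmul (b : B) : tmul (0 : A) b = 0 := by
  simp [← tmulBilin_apply]

theorem tmul_sum {ι : Type*} (s : Finset ι) (a : A) (b : ι → B) :
    tmul a (∑ i ∈ s, b i) = ∑ i ∈ s, tmul a (b i) := by
  simp [← tmulBilin_apply]

variable (A B) in
/-- The embedding `a ↦ a ⊗ 1`. -/
noncomputable def inl : A →⋆ₐ[ℂ] MinTensor A B :=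
  (ofAlgebraic A B).comp { Algebra.TensorProduct.includeLeft with
    map_star' := fun a => by simp [TensorProduct.star_tmul] }

variable (A B) in
/-- The embedding `b ↦ 1 ⊗ b`. -/
noncomputable def inr : B →⋆ₐ[ℂ] MinTensor A B :=
  (ofAlgebraic A B).comp { Algebra.TensorProduct.includeRight with
    map_star' := fun a => by simp [TensorProduct.star_tmul] }

theorem inl_apply (a : A) : inl A B a = tmul a 1 := rfl

theorem inr_apply (b : B) : inr A B b = tmul 1 b := rfl

theorem inl_mul_inr (a : A) (b : B) : inl A B a * inr A B b = tmul a b := by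
  rw [inl_apply, inr_apply, tmul_mul_tmul, one_mul, mul_one]

theorem norm_tmul_le (a : A) (b : B) : ‖tmul a b‖ ≤ ‖a‖ * ‖b‖ := by
  rw [← inl_mul_inr]
  exact (norm_mul_le _ _).trans (mul_le_mul (NonUnitalStarAlgHom.norm_apply_le _ a)
    (NonUnitalStarAlgHom.norm_apply_le _ b) (norm_nonneg _) (norm_nonneg _))

/-- The coordinate of the minimal tensor product at a pair of representations. -/
noncomputable def evalRep (r : HilbertRep A × HilbertRep B) : MinTensor A B →⋆ₐ[ℂ] RepAlg r :=
  (lpEval (C := fun r : HilbertRep A × HilbertRep B => RepAlg r) r).comp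
    (toRepProd A B).range.topologicalClosure.subtype

theorem exists_evalRep_ne_zero {x : MinTensor A B} (hx : x ≠ 0) :
    ∃ r : HilbertRep A × HilbertRep B, evalRep r x ≠ 0 := by
  by_contra! h
  exact hx (Subtype.ext (lp.ext (funext h)))

theorem exists_list_isSelfAdjoint (t : A ⊗[ℂ] B) :
    ∃ l : List (A × B), (∀ p ∈ l, IsSelfAdjoint p.2) ∧ (l.map fun p => p.1 ⊗ₜ[ℂ] p.2).sum = t := by
  induction t with
  | zero => exact ⟨[], by simp, by simp⟩
  | add s t hs ht =>
    obtain ⟨l, hl, rfl⟩ := hs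
    obtain ⟨m, hm, rfl⟩ := ht
    exact ⟨l ++ m, fun p hp => (List.mem_append.mp hp).elim (hl p) (hm p), by simp⟩
  | tmul a b =>
    refine ⟨[(a, realPart b), (Complex.I • a, imaginaryPart b)], ?_, ?_⟩
    · simp
    · simp only [List.map_cons, List.map_nil, List.sum_cons, List.sum_nil, add_zero,
        TensorProduct.smul_tmul, ← TensorProduct.tmul_add]
      rw [realPart_add_I_smul_imaginaryPart]

/-- Once the second factors are self-adjoint, the real part of the sum is found by taking real parts
of the first factors. Real parts do not increase the distance to the self-adjoint `z`. -/
theorem exists_list_norm_sub_lt {z : MinTensor A B} (hz : IsSelfAdjoint z) {ε : ℝ} (hε : 0 < ε) :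
    ∃ l : List (A × B), (∀ p ∈ l, IsSelfAdjoint p.1 ∧ IsSelfAdjoint p.2) ∧
      ‖z - (l.map fun p => tmul p.1 p.2).sum‖ < ε := by
  obtain ⟨t, ht⟩ := denseRange_ofAlgebraic.exists_dist_lt z hε
  rw [dist_eq_norm] at ht
  obtain ⟨l, hl, rfl⟩ := exists_list_isSelfAdjoint t
  refine ⟨l.map fun p => ((realPart p.1 : A), p.2), ?_, ?_⟩
  · intro p hp
    obtain ⟨q, hq, rfl⟩ := List.mem_map.mp hp
    exact ⟨(realPart q.1).2, hl q hq⟩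
  · have h1 (l : List (A × B)) (hl : ∀ p ∈ l, IsSelfAdjoint p.2) :
        ((l.map fun p => ((realPart p.1 : A), p.2)).map fun p => tmul p.1 p.2).sum =
        (realPart (ofAlgebraic A B (l.map fun p => p.1 ⊗ₜ[ℂ] p.2).sum) : MinTensor A B) := by
      induction l with
      | nil => simp
      | cons p l ih =>
        simp only [List.map_cons, List.sum_cons, map_add, AddSubgroup.coe_add,
          ih fun q hq => hl q (List.mem_cons_of_mem _ hq), ofAlgebraic_tmul]
        congr 1
        rw [realPart_apply_coe, realPart_apply_coe, star_tmul, (hl p List.mem_cons_self).star_eq,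
          ← add_tmul, smul_tmul_real]
    rw [h1 l hl, ← hz.coe_realPart, ← AddSubgroup.coe_sub, ← map_sub]
    exact (realPart.norm_le _).trans_lt ht

theorem exists_sum_norm_sub_lt {z : MinTensor A B} (hz : IsSelfAdjoint z) {ε : ℝ} (hε : 0 < ε) :
    ∃ (n : ℕ) (a : Fin n → A) (b : Fin n → B), (∀ i, IsSelfAdjoint (a i)) ∧
      (∀ i, IsSelfAdjoint (b i)) ∧ ‖z - ∑ i, tmul (a i) (b i)‖ < ε := by
  obtain ⟨l, hl, h⟩ := exists_list_norm_sub_lt hz hε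
  refine ⟨l.length, fun i => l[i].1, fun i => l[i].2, fun i => (hl _ (l.getElem_mem _)).1,
    fun i => (hl _ (l.getElem_mem _)).2, ?_⟩
  convert h using 3
  exact Fin.sum_univ_fun_getElem l fun p => tmul p.1 p.2

end Basic

end MinTensor

/-! ### Vector states and their products -/

/-- The vector functional `a ↦ ⟪x, π a x⟫`. -/
noncomputable def HilbertRep.vectorState {A : Type u} [CStarAlgebra A] (π : HilbertRep A)
    (x : π.H) : A →ₗ[ℂ] ℂ where
  toFun a := inner ℂ x (π.toHom a x)
  map_add' a b := by simp
  map_smul' c a := by simp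

namespace HilbertRep

variable {A : Type u} [CStarAlgebra A] (π : HilbertRep A) (x : π.H)

theorem vectorState_apply (a : A) : π.vectorState x a = inner ℂ x (π.toHom a x) := rfl

theorem vectorState_star (a : A) :
    π.vectorState x (star a) = starRingEnd ℂ (π.vectorState x a) := by
  rw [vectorState_apply, vectorState_apply, map_star, ContinuousLinearMap.star_eq_adjoint,
    ContinuousLinearMap.adjoint_inner_right, inner_conj_symm]

theorem vectorState_im {a : A} (ha : IsSelfAdjoint a) : (π.vectorState x a).im = 0 := by
  rw [← Complex.conj_eq_iff_im, ← vectorState_star, ha.star_eq]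

theorem vectorState_star_mul_self (a : A) :
    π.vectorState x (star a * a) = (‖π.toHom a x‖ ^ 2 : ℝ) := by
  rw [vectorState_apply, map_mul, map_star, ContinuousLinearMap.star_eq_adjoint,
    mul_apply_eq_comp, ContinuousLinearMap.adjoint_inner_right,
    inner_self_eq_norm_sq_to_K]
  simp

theorem norm_vectorState_le (hx : ‖x‖ = 1) (a : A) : ‖π.vectorState x a‖ ≤ ‖a‖ := by
  calc _ ≤ ‖x‖ * ‖π.toHom a x‖ := norm_inner_le_norm _ _
    _ ≤ ‖x‖ * (‖π.toHom a‖ * ‖x‖) := by gcongr; exact (π.toHom a).le_opNorm x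
    _ = ‖π.toHom a‖ := by rw [hx]; ring
    _ ≤ ‖a‖ := NonUnitalStarAlgHom.norm_apply_le π.toHom a

theorem re_vectorState_le [PartialOrder A] [StarOrderedRing A] (hx : ‖x‖ = 1) {a : A} {s : ℝ}
    (h : a ≤ algebraMap ℝ A s) : (π.vectorState x a).re ≤ s := by
  obtain ⟨w, hw⟩ := CStarAlgebra.nonneg_iff_eq_star_mul_self.mp (sub_nonneg.mpr h)
  have h1 := congrArg (fun b => (π.vectorState x b).re) hw
  have h2 : π.vectorState x 1 = 1 := by
    rw [vectorState_apply, map_one, one_apply_eq_self, inner_self_eq_norm_sq_to_K, hx]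
    simp
  simp only [vectorState_star_mul_self, map_sub, Algebra.algebraMap_eq_smul_one,
    ← Complex.coe_smul, map_smul, h2, Complex.sub_re, Complex.ofReal_re] at h1
  simp at h1
  nlinarith [sq_nonneg ‖π.toHom w x‖]

end HilbertRep

namespace MinTensor

variable {A : Type u} {B : Type v} [CStarAlgebra A] [CStarAlgebra B]

/-- A nonzero positive element is detected by a product of vector states. -/
theorem exists_vectorState_re_pos (w : MinTensor A B) (hw : w ≠ 0) :
    ∃ (π : HilbertRep A) (x : π.H) (ρ : HilbertRep B) (y : ρ.H) (Φ : MinTensor A B →ₗ[ℂ] ℂ),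
      ‖x‖ = 1 ∧ ‖y‖ = 1 ∧ (∀ d, ‖Φ d‖ ≤ ‖d‖) ∧
      (∀ a b, Φ (tmul a b) = π.vectorState x a * ρ.vectorState y b) ∧ 0 < (Φ (star w * w)).re := by
  obtain ⟨r, hr⟩ := exists_evalRep_ne_zero hw
  let toOp (d : MinTensor A B) :
      Completion (r.1.H ⊗[ℂ] r.2.H) →L[ℂ] Completion (r.1.H ⊗[ℂ] r.2.H) :=
    evalRep r d
  -- An operator killing all elementary vectors `x ⊗ y` is zero, since they span a dense subspace.
  obtain ⟨x, y, hxy⟩ : ∃ x y, toOp w ((x ⊗ₜ[ℂ] y : r.1.H ⊗[ℂ] r.2.H) : Completion _) ≠ 0 := by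
    by_contra! h
    refine hr (completion_ext (S := toOp w) (T := 0) fun t => ?_)
    induction t with
    | zero => simp [Completion.coe_zero]
    | add s t hs ht => rw [Completion.coe_add, map_add, hs, ht]; simp
    | tmul x y => rw [h]; simp
  have hx0 : x ≠ 0 := by rintro rfl; simp [Completion.coe_zero] at hxy
  have hy0 : y ≠ 0 := by rintro rfl; simp [Completion.coe_zero] at hxy
  obtain ⟨x, y, hx, hy, hxy⟩ : ∃ x y, ‖x‖ = 1 ∧ ‖y‖ = 1 ∧
      toOp w ((x ⊗ₜ[ℂ] y : r.1.H ⊗[ℂ] r.2.H) : Completion _) ≠ 0 := by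
    refine ⟨(‖x‖⁻¹ : ℂ) • x, (‖y‖⁻¹ : ℂ) • y, norm_smul_inv_norm hx0, norm_smul_inv_norm hy0, ?_⟩
    rw [TensorProduct.smul_tmul_smul, Completion.coe_smul, map_smul]
    exact smul_ne_zero (by simp [hx0, hy0]) hxy
  set ξ : Completion (r.1.H ⊗[ℂ] r.2.H) :=
    ((x ⊗ₜ[ℂ] y : r.1.H ⊗[ℂ] r.2.H) : Completion (r.1.H ⊗[ℂ] r.2.H)) with hξ
  have hξ1 : ‖ξ‖ = 1 := by rw [hξ, Completion.norm_coe]; simp [hx, hy]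
  have toOp_add (d e) : toOp (d + e) = toOp d + toOp e := map_add (evalRep r) d e
  have toOp_smul (c : ℂ) (d) : toOp (c • d) = c • toOp d := map_smul (evalRep r) c d
  have toOp_mul (d e) : toOp (d * e) = toOp d * toOp e := map_mul (evalRep r) d e
  have toOp_star (d) : toOp (star d) = star (toOp d) := map_star (evalRep r) d
  have toOp_norm (d) : ‖toOp d‖ ≤ ‖d‖ := NonUnitalStarAlgHom.norm_apply_le (evalRep r) d
  refine ⟨r.1, x, r.2, y,
    { toFun := fun d => inner ℂ ξ (toOp d ξ)
      map_add' := fun d e => by rw [toOp_add, _root_.add_apply, inner_add_right]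
      map_smul' := fun c d => by
        rw [toOp_smul, _root_.smul_apply, inner_smul_right]; rfl },
    hx, hy, fun d => ?_, fun a b => ?_, ?_⟩
  · calc _ ≤ ‖ξ‖ * ‖toOp d ξ‖ := norm_inner_le_norm _ _
      _ ≤ ‖ξ‖ * (‖toOp d‖ * ‖ξ‖) := by gcongr; exact (toOp d).le_opNorm ξ
      _ = ‖toOp d‖ := by rw [hξ1]; ring
      _ ≤ ‖d‖ := toOp_norm d
  · change inner ℂ ξ (tensorOp (r.1.toHom a) (r.2.toHom b) ξ) = _
    rw [hξ, tensorOp_coe, Completion.inner_coe, TensorProduct.mapL_tmul, TensorProduct.inner_tmul]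
    rfl
  · change 0 < (inner ℂ ξ (toOp (star w * w) ξ)).re
    rw [toOp_mul, toOp_star, ContinuousLinearMap.star_eq_adjoint, mul_apply_eq_comp,
      ContinuousLinearMap.adjoint_inner_right, inner_self_eq_norm_sq_to_K]
    have : 0 < ‖toOp w ξ‖ := norm_pos_iff.mpr hxy
    have h1 : ((‖toOp w ξ‖ : ℂ) ^ 2).re = ‖toOp w ξ‖ ^ 2 := by
      rw [← Complex.ofReal_pow, Complex.ofReal_re]
    exact (pow_pos this 2).trans_eq h1.symm

end MinTensor

/-! ### The slice lemma and comparison with `a ⊗ 1` -/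

namespace MinTensor

variable {A : Type u} {B : Type v} [CStarAlgebra A] [CStarAlgebra B]

/-- A nonzero positive element is, after compression by a positive norm-one element of `1 ⊗ B`,
close to an elementary tensor whose first factor is bounded away from zero. -/
theorem exists_norm_conj_sub_tmul_le [PartialOrder B] [StarOrderedRing B] [Nontrivial B]
    {w : MinTensor A B} (hw : w ≠ 0) :
    ∃ (π : HilbertRep A) (x : π.H) (c : ℝ) (a : A) (h : B), ‖x‖ = 1 ∧ 0 < c ∧
      IsSelfAdjoint a ∧ 0 ≤ h ∧ ‖h‖ = 1 ∧ c / 2 ≤ (π.vectorState x a).re ∧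
      ‖tmul 1 h * (star w * w) * tmul 1 h - tmul a (h * h)‖ ≤ c / 16 := by
  obtain ⟨π, x, ρ, y, Φ, hx, hy, hΦ, hΦt, hc⟩ := exists_vectorState_re_pos w hw
  set z := star w * w with hz
  have hzs : IsSelfAdjoint z := .star_mul_self w
  set c := (Φ z).re with hcdef
  obtain ⟨n, a, b, ha, hb, hab⟩ := exists_sum_norm_sub_lt hzs (show 0 < c / 32 by positivity)
  set z' := ∑ i, tmul (a i) (b i) with hz'
  set φ : A → ℝ := fun a => (π.vectorState x a).re with hφ
  -- The slice of `z'` by the vector state of `A`. The second vector state takes a value close to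
  -- `c` on it, so the top `μ` of its spectrum is at least `c - c / 32`.
  set w' : B := ∑ i, φ (a i) • b i with hw'
  have hw's : IsSelfAdjoint w' := by
    rw [hw', IsSelfAdjoint, star_sum]
    exact Finset.sum_congr rfl fun i _ => by rw [star_smul, (hb i).star_eq, star_trivial]
  have hψ : c - c / 32 ≤ (ρ.vectorState y w').re := by
    have h1 : (ρ.vectorState y w').re = (Φ z').re := by
      rw [hw', hz', map_sum, map_sum, Complex.re_sum, Complex.re_sum]
      refine Finset.sum_congr rfl fun i _ => ?_
      rw [hΦt, Complex.mul_re, π.vectorState_im x (ha i), ← Complex.coe_smul, map_smul,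
        smul_eq_mul, Complex.re_ofReal_mul]
      ring
    have h2 : (Φ (z - z')).re ≤ c / 32 :=
      (Complex.re_le_norm _).trans ((hΦ _).trans hab.le)
    rw [map_sub, Complex.sub_re] at h2
    rw [h1]; linarith
  set C := ‖w'‖ with hC
  set W : B := w' + algebraMap ℝ B C with hW
  have hW0 : 0 ≤ W := by
    have := hw's.neg_algebraMap_norm_le_self
    rwa [← sub_nonneg, sub_neg_eq_add] at this
  set μ := ‖W‖ - C with hμ
  have hμc : c - c / 32 ≤ μ := by
    refine hψ.trans (ρ.re_vectorState_le y hy ?_)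
    rw [hμ, map_sub, le_sub_iff_add_le]
    exact (IsSelfAdjoint.of_nonneg hW0).le_algebraMap_norm_self
  set S := ∑ i, ‖a i‖ with hS
  have hS0 : 0 ≤ S := Finset.sum_nonneg fun i _ => norm_nonneg _
  have hφS : ∑ i, |φ (a i)| ≤ S := Finset.sum_le_sum fun i _ =>
    (Complex.abs_re_le_norm _).trans (π.norm_vectorState_le x hx (a i))
  -- The denominator collects the coefficients of `δ` in the two estimates of `h w' h` below, so
  -- that together they cost exactly `c / 32`.
  set δ := c / 32 / (S + C + |μ| + 1) with hδ
  have hδ0 : 0 < δ := by positivity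
  have hδc : S * δ + C * δ + |μ| * δ + δ = c / 32 := by
    have : S + C + |μ| + 1 ≠ 0 := by positivity
    calc _ = (S + C + |μ| + 1) * δ := by ring
      _ = c / 32 := mul_div_cancel₀ _ this
  obtain ⟨h₀, h₀0, h₀1, h₀W⟩ := exists_nonneg_norm_one_mul_sub_le hW0 hδ0
  have h₀w : ‖w' * h₀ - μ • h₀‖ ≤ δ := by
    have : W * h₀ = w' * h₀ + C • h₀ := by
      rw [hW, add_mul, Algebra.algebraMap_eq_smul_one, smul_mul_assoc, one_mul]
    convert h₀W using 2
    rw [this, hμ, sub_smul]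
    abel
  -- This `h` excises all the `b i` at once and is almost fixed by `h₀`, so it remains an
  -- approximate top eigenvector of `w'`. Compressing `z'` by `1 ⊗ h` then gives nearly `(∑ r i • a
  -- i) ⊗ h²`.
  obtain ⟨h, hh0, hh1, h₀h, hr⟩ := exists_nonneg_norm_one_excision_list h₀0 h₀1 (List.ofFn b)
    (fun b' hb' => by obtain ⟨i, rfl⟩ := List.mem_ofFn.mp hb'; exact hb i) hδ0
  have hr (i : Fin n) := hr (b i) (List.mem_ofFn.mpr ⟨i, rfl⟩)
  choose r hr using hr
  have hhs : IsSelfAdjoint h := .of_nonneg hh0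
  have hhh : ‖h * h‖ = 1 := by
    have := CStarRing.norm_star_mul_self (x := h)
    rwa [hhs.star_eq, hh1, mul_one] at this
  set y₁ : A := ∑ i, r i • a i with hy₁
  have hy₁s : IsSelfAdjoint y₁ := by
    rw [hy₁, IsSelfAdjoint, star_sum]
    exact Finset.sum_congr rfl fun i _ => by rw [star_smul, (ha i).star_eq, star_trivial]
  have hφy : φ y₁ = ∑ i, φ (a i) * r i := by
    simp only [hφ, hy₁, map_sum, Complex.re_sum, ← Complex.coe_smul, map_smul, smul_eq_mul,
      Complex.re_ofReal_mul, mul_comm]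
  have e1 : ‖h * w' * h - φ y₁ • (h * h)‖ ≤ S * δ := by
    have : h * w' * h - φ y₁ • (h * h) = ∑ i, φ (a i) • (h * b i * h - r i • (h * h)) := by
      simp only [hφy, hw', Finset.mul_sum, Finset.sum_mul, Finset.sum_smul,
        ← Finset.sum_sub_distrib, mul_smul_comm, smul_mul_assoc, smul_sub, mul_smul]
    rw [this]
    calc _ ≤ ∑ i, |φ (a i)| * δ := norm_sum_le_of_le _ fun i _ => by
          rw [norm_smul, Real.norm_eq_abs]; gcongr; exact hr i
      _ ≤ S * δ := by rw [← Finset.sum_mul]; gcongr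
  have e2 : ‖h * w' * h - μ • (h * h)‖ ≤ δ + C * δ + |μ| * δ := by
    have : h * w' * h - μ • (h * h) = h * (w' * h₀ - μ • h₀) * h - h * w' * (h₀ * h - h)
        + μ • (h * (h₀ * h - h)) := by
      simp only [sub_mul, mul_sub, smul_mul_assoc, mul_smul_comm, mul_assoc, smul_sub]
      abel
    rw [this]
    calc _ ≤ ‖h * (w' * h₀ - μ • h₀) * h‖ + ‖h * w' * (h₀ * h - h)‖
          + ‖μ • (h * (h₀ * h - h))‖ :=
          (norm_add_le _ _).trans (by gcongr; exact norm_sub_le _ _)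
      _ ≤ 1 * δ * 1 + 1 * C * δ + |μ| * (1 * δ) := by
        gcongr
        · exact norm_mul₃_le.trans (by rw [hh1]; gcongr)
        · exact norm_mul₃_le.trans (by rw [hh1]; gcongr)
        · rw [norm_smul, Real.norm_eq_abs]
          gcongr
          exact (norm_mul_le _ _).trans (by rw [hh1]; gcongr)
      _ = _ := by ring
  -- Excision gives `h w' h ≈ φ(y₁) h²` and the eigenvector property gives `h w' h ≈ μ h²`. As `‖h²‖
  -- = 1`, the two scalars must be close.
  have e3 : |μ - φ y₁| ≤ c / 32 := by
    calc |μ - φ y₁| = ‖(μ - φ y₁) • (h * h)‖ := by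
          rw [norm_smul, hhh, mul_one, Real.norm_eq_abs]
      _ = ‖(h * w' * h - φ y₁ • (h * h)) - (h * w' * h - μ • (h * h))‖ := by
        rw [sub_smul]; congr 1; abel
      _ ≤ S * δ + (δ + C * δ + |μ| * δ) := (norm_sub_le _ _).trans (add_le_add e1 e2)
      _ = c / 32 := by rw [← hδc]; ring
  refine ⟨π, x, c, y₁, h, hx, hc, hy₁s, hh0, hh1, ?_, ?_⟩
  · have := (abs_le.mp e3).2
    change c / 2 ≤ φ y₁
    linarith
  · have h1h : ‖tmul (1 : A) h‖ ≤ 1 := by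
      rw [← hh1]
      exact NonUnitalStarAlgHom.norm_apply_le (inr A B) h
    have : tmul 1 h * z * tmul 1 h - tmul y₁ (h * h) =
        tmul 1 h * (z - z') * tmul 1 h + ∑ i, tmul (a i) (h * b i * h - r i • (h * h)) := by
      have e4 : tmul 1 h * z' * tmul 1 h = ∑ i, tmul (a i) (h * b i * h) := by
        simp only [hz', Finset.mul_sum, Finset.sum_mul, tmul_mul_tmul, one_mul, mul_one]
      have e5 : tmul y₁ (h * h) = ∑ i, tmul (a i) (r i • (h * h)) := by
        simp only [hy₁, ← tmulBilin_apply, map_sum, LinearMap.sum_apply]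
        simp only [tmulBilin_apply, smul_tmul_real, tmul_smul_real]
      simp only [mul_sub, sub_mul, e4, e5, tmul_sub, Finset.sum_sub_distrib]
      abel
    rw [this]
    calc _ ≤ 1 * (c / 32) * 1 + ∑ i, ‖a i‖ * δ := by
          refine (norm_add_le _ _).trans (add_le_add ?_ ?_)
          · exact norm_mul₃_le.trans (by gcongr)
          · exact norm_sum_le_of_le _ fun i _ => (norm_tmul_le _ _).trans (by gcongr; exact hr i)
      _ ≤ c / 16 := by
        rw [← Finset.sum_mul, ← hS]
        have := mul_nonneg (norm_nonneg w') hδ0.le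
        have := mul_nonneg (abs_nonneg μ) hδ0.le
        linarith

section Order

variable [PartialOrder A] [StarOrderedRing A] [PartialOrder B] [StarOrderedRing B]
  [PartialOrder (MinTensor A B)] [StarOrderedRing (MinTensor A B)]

theorem tmul_nonneg {a : A} {b : B} (ha : 0 ≤ a) (hb : 0 ≤ b) : 0 ≤ tmul a b := by
  obtain ⟨s, rfl⟩ := CStarAlgebra.nonneg_iff_eq_star_mul_self.mp ha
  obtain ⟨t, rfl⟩ := CStarAlgebra.nonneg_iff_eq_star_mul_self.mp hb
  rw [← tmul_mul_tmul, ← star_tmul]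
  exact star_mul_self_nonneg _

theorem tmul_le_tmul_left {a a' : A} {b : B} (ha : a ≤ a') (hb : 0 ≤ b) :
    tmul a b ≤ tmul a' b := by
  rw [← sub_nonneg, ← sub_tmul]
  exact tmul_nonneg (sub_nonneg.mpr ha) hb

theorem tmul_le_tmul_right {a : A} {b b' : B} (ha : 0 ≤ a) (hb : b ≤ b') :
    tmul a b ≤ tmul a b' := by
  rw [← sub_nonneg, ← tmul_sub]
  exact tmul_nonneg ha (sub_nonneg.mpr hb)

/-- Kirchberg's slice lemma. -/
theorem exists_tmul_le_conj [Nontrivial B] {z : MinTensor A B} (hz : 0 ≤ z) (hz0 : z ≠ 0) :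
    ∃ (a : A) (b : B) (v : MinTensor A B), 0 ≤ a ∧ a ≠ 0 ∧ 0 ≤ b ∧ b ≠ 0 ∧
      tmul a b ≤ v * z * star v := by
  obtain ⟨w, rfl⟩ := CStarAlgebra.nonneg_iff_eq_star_mul_self.mp hz
  have hw : w ≠ 0 := by rintro rfl; simp at hz0
  obtain ⟨π, x, c, y, h, hx, hc, hy, hh0, hh1, hφ, hE⟩ := exists_norm_conj_sub_tmul_le hw
  set z := star w * w with hzdef
  have hhs : IsSelfAdjoint h := .of_nonneg hh0
  -- The cut-offs `k` of `y` at `c / 4` and `l` of `h²` at `1 / 2` are nonzero because a state takes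
  -- a value at least `c / 2` on `y` and `‖h²‖ = 1`.
  obtain ⟨k, hk0, hk, hky⟩ := exists_nonneg_smul_le_conj hy (c / 4)
  have hh2 : IsSelfAdjoint (h * h) := .of_nonneg hhs.mul_self_nonneg
  obtain ⟨l, hl0, hl, hlh⟩ := exists_nonneg_smul_le_conj hh2 (1 / 2)
  have hks : IsSelfAdjoint k := .of_nonneg hk0
  have hls : IsSelfAdjoint l := .of_nonneg hl0
  have hk1 : k ≠ 0 := fun h0 => by
    have := π.re_vectorState_le x hx (hky h0)
    linarith
  have hl1 : l ≠ 0 := fun h0 => by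
    have h1 := (CStarAlgebra.norm_le_iff_le_algebraMap (h * h) (by norm_num)
      hhs.mul_self_nonneg).mpr (hlh h0)
    have h2 := CStarRing.norm_star_mul_self (x := h)
    rw [hhs.star_eq, hh1] at h2
    linarith
  -- Compression by `k ⊗ l` leaves at least `(c / 4)(1 / 2) k² ⊗ l²` from the main term, and the
  -- error removes at most `c / 16` of it.
  refine ⟨(c / 16) • (k * k), l * l, tmul k (l * h),
    smul_nonneg (by positivity) hks.mul_self_nonneg,
    smul_ne_zero (by positivity) fun h0 => hk1 (hks.eq_zero_of_mul_self_eq_zero h0),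
    hls.mul_self_nonneg,
    fun h0 => hl1 (hls.eq_zero_of_mul_self_eq_zero h0), ?_⟩
  set E := tmul 1 h * z * tmul 1 h - tmul y (h * h) with hEdef
  have h1h : IsSelfAdjoint (tmul (1 : A) h) := hhs.map (inr A B)
  have hEs : IsSelfAdjoint E := by
    refine .sub (.of_nonneg (h1h.conjugate_nonneg hz)) ?_
    rw [IsSelfAdjoint, star_tmul, hy.star_eq, hh2.star_eq]
  have hkl : IsSelfAdjoint (tmul k l) := by
    rw [IsSelfAdjoint, star_tmul, hks.star_eq, hls.star_eq]
  have hE1 : -algebraMap ℝ (MinTensor A B) (c / 16) ≤ E :=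
    (neg_le_neg (algebraMap_mono _ hE)).trans hEs.neg_algebraMap_norm_le_self
  have hE2 := hkl.conjugate_le_conjugate hE1
  have e1 : tmul k l * -algebraMap ℝ (MinTensor A B) (c / 16) * tmul k l =
      -((c / 16) • tmul (k * k) (l * l)) := by
    rw [Algebra.algebraMap_eq_smul_one, mul_neg, neg_mul, mul_smul_comm, mul_one, smul_mul_assoc,
      tmul_mul_tmul]
  have e2 : tmul k l * E * tmul k l =
      tmul k (l * h) * z * star (tmul k (l * h)) - tmul (k * y * k) (l * (h * h) * l) := by
    have : tmul k (l * h) = tmul k l * tmul 1 h := by rw [tmul_mul_tmul, mul_one]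
    rw [this, star_mul, h1h.star_eq, hkl.star_eq, hEdef, mul_sub, sub_mul, tmul_mul_tmul,
      tmul_mul_tmul]
    noncomm_ring
  have e3 : (c / 8) • tmul (k * k) (l * l) ≤ tmul (k * y * k) (l * (h * h) * l) :=
    calc _ = tmul ((c / 4) • (k * k)) ((1 / 2 : ℝ) • (l * l)) := by
          rw [smul_tmul_real, tmul_smul_real, smul_smul]; congr 1; ring
      _ ≤ tmul ((c / 4) • (k * k)) (l * (h * h) * l) :=
        tmul_le_tmul_right (smul_nonneg (by positivity) hks.mul_self_nonneg) hl
      _ ≤ _ := tmul_le_tmul_left hk (hls.conjugate_nonneg hhs.mul_self_nonneg)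
  rw [e1, e2] at hE2
  rw [smul_tmul_real]
  rw [← sub_nonneg] at hE2 e3 ⊢
  convert add_nonneg hE2 e3 using 1
  module

theorem exists_inl_le_conj (hA : IsSimpleCStar A) (hmin : ∀ p : A, ¬ IsMinimalProjection p)
    (hB : IsSimpleCStar B) {z : MinTensor A B} (hz : 0 ≤ z) (hz0 : z ≠ 0) :
    ∃ (a : A) (v : MinTensor A B), 0 ≤ a ∧ a ≠ 0 ∧ inl A B a ≤ v * z * star v := by
  classical
  have := hB.1
  obtain ⟨a, b, v, ha, ha0, hb, hb0, hv⟩ := exists_tmul_le_conj hz hz0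
  obtain ⟨ι, _, c, hc⟩ := hB.exists_one_le_sum_conj hb hb0
  obtain ⟨d, a', ha', ha'0, hd⟩ := hA.exists_orthogonal_family_conj_eq hmin ha ha0 ι
  -- Orthogonality of the `d i` relative to `a` kills the off-diagonal terms of `V (a ⊗ b) V*`,
  -- while the diagonal ones share the first factor `a'`, so the `c i b c i*` add up in the second.
  set V : MinTensor A B := ∑ i, tmul (d i) (c i) with hV
  refine ⟨a', V * v, ha', ha'0, ?_⟩
  calc inl A B a' ≤ tmul a' (∑ i, c i * b * star (c i)) := tmul_le_tmul_right ha' hc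
    _ = V * tmul a b * star V := by
      simp only [hV, tmul_sum, star_sum, Finset.sum_mul, Finset.mul_sum, star_tmul, tmul_mul_tmul,
        hd]
      rw [Finset.sum_comm]
      refine Finset.sum_congr rfl fun i _ => ?_
      rw [Finset.sum_eq_single i]
      · simp
      · intro j _ hj; simp [hj.symm, zero_tmul]
      · simp
    _ ≤ V * (v * z * star v) * star V := star_right_conjugate_le_conjugate hv V
    _ = _ := by rw [star_mul]; noncomm_ring

end Order

end MinTensor

/-! ### Functoriality of ultrapowers and transfer of central sequences -/

namespace Ultrapower

variable {ω : Ultrafilter ℕ} {A B C : Type*} [CStarAlgebra A] [CStarAlgebra B] [CStarAlgebra C]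

theorem map_mk (φ : A →⋆ₐ[ℂ] B) (x : ℕ →ᵇ A) :
    Ultrapower.map ω φ (mk ω A x) = mk ω B (seqMap φ x) := rfl

theorem map_map (φ : A →⋆ₐ[ℂ] B) (ψ : B →⋆ₐ[ℂ] C) (e : Ultrapower ω A) :
    Ultrapower.map ω ψ (Ultrapower.map ω φ e) = Ultrapower.map ω (ψ.comp φ) e := by
  obtain ⟨x, rfl⟩ := Ideal.Quotient.mk_surjective e
  rfl

theorem map_star_apply (φ : A →⋆ₐ[ℂ] B) (e : Ultrapower ω A) :
    Ultrapower.map ω φ (star e) = star (Ultrapower.map ω φ e) := by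
  obtain ⟨x, rfl⟩ := Ideal.Quotient.mk_surjective e
  refine congrArg (mk ω B) ?_
  ext n
  exact map_star φ (x n)

theorem norm_mk_le (x : ℕ →ᵇ A) : ‖mk ω A x‖ ≤ ‖x‖ :=
  Submodule.Quotient.norm_mk_le (cOmega ω A) x

theorem norm_map_le (φ : A →⋆ₐ[ℂ] B) (e : Ultrapower ω A) : ‖Ultrapower.map ω φ e‖ ≤ ‖e‖ := by
  refine le_of_forall_pos_le_add fun ε hε => ?_
  obtain ⟨x, rfl, hx⟩ := Submodule.Quotient.norm_mk_lt e hε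
  refine (norm_mk_le (seqMap φ x)).trans (le_trans ?_ hx.le)
  exact (BoundedContinuousFunction.norm_le (norm_nonneg _)).mpr fun n =>
    (NonUnitalStarAlgHom.norm_apply_le φ (x n)).trans (x.norm_coe_le_norm n)

theorem mk_eq_mk_iff {x y : ℕ →ᵇ A} :
    mk ω A x = mk ω A y ↔ Tendsto (fun n => ‖x n - y n‖) ω (𝓝 0) :=
  Ideal.Quotient.eq

theorem mk_mem_centralSequences_iff {x : ℕ →ᵇ A} :
    mk ω A x ∈ centralSequences ω A ↔
      ∀ a, Tendsto (fun n => ‖x n * a - a * x n‖) ω (𝓝 0) := by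
  rw [centralSequences, Subring.mem_centralizer_iff, Set.forall_mem_range]
  refine forall_congr' fun a => ?_
  rw [← map_mul, ← map_mul, eq_comm, mk_eq_mk_iff]
  rfl

end Ultrapower

theorem IsPos.map_ultrapower {ω : Ultrafilter ℕ} {A B : Type*} [CStarAlgebra A] [CStarAlgebra B]
    (φ : A →⋆ₐ[ℂ] B) {e : Ultrapower ω A} (he : IsPos e) : IsPos (Ultrapower.map ω φ e) := by
  obtain ⟨y, rfl⟩ := he
  exact ⟨Ultrapower.map ω φ y, by rw [map_mul, Ultrapower.map_star_apply]⟩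

theorem IsStarProjection.map_ultrapower {ω : Ultrafilter ℕ} {A B : Type*} [CStarAlgebra A]
    [CStarAlgebra B] (φ : A →⋆ₐ[ℂ] B) {e : Ultrapower ω A} (he : IsStarProjection e) :
    IsStarProjection (Ultrapower.map ω φ e) :=
  ⟨he.isIdempotentElem.map _, by
    rw [IsSelfAdjoint, ← Ultrapower.map_star_apply, he.isSelfAdjoint.star_eq]⟩

theorem PointwiseCuntzLE.map {ω : Ultrafilter ℕ} {A B : Type*} [CStarAlgebra A] [CStarAlgebra B]
    (φ : A →⋆ₐ[ℂ] B) {f : Ultrapower ω A} {a : A} (h : PointwiseCuntzLE f a) :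
    PointwiseCuntzLE (Ultrapower.map ω φ f) (φ a) := by
  obtain ⟨x, rfl, hx⟩ := h
  refine ⟨seqMap φ x, rfl, fun n => ⟨?_, (hx n).2.map φ⟩⟩
  obtain ⟨y, hy⟩ := (hx n).1
  exact ⟨φ y, by rw [← map_star, ← map_mul, ← hy]; rfl⟩

theorem PointwiseCuntzLE.trans {ω : Ultrafilter ℕ} {A : Type*} [CStarAlgebra A]
    {f : Ultrapower ω A} {a b : A} (h : PointwiseCuntzLE f a) (hab : CuntzLE a b) :
    PointwiseCuntzLE f b := by
  obtain ⟨x, rfl, hx⟩ := h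
  exact ⟨x, rfl, fun n => ⟨(hx n).1, (hx n).2.trans hab⟩⟩

namespace MinTensor

variable {A : Type u} {B : Type v} [CStarAlgebra A] [CStarAlgebra B]

/-- Commutators with `a ⊗ b` are `[x n, a] ⊗ b` and tend to zero. Boundedness of the sequence
extends this from the dense algebraic tensor product to all of the completion. -/
theorem map_inl_mem_centralSequences {ω : Ultrafilter ℕ} {e : Ultrapower ω A}
    (he : e ∈ centralSequences ω A) :
    Ultrapower.map ω (inl A B) e ∈ centralSequences ω (MinTensor A B) := by
  obtain ⟨x, rfl⟩ := Ideal.Quotient.mk_surjective e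
  rw [Ultrapower.mk_mem_centralSequences_iff] at he
  rw [Ultrapower.map_mk, Ultrapower.mk_mem_centralSequences_iff]
  change ∀ d, Tendsto (fun n => ‖inl A B (x n) * d - d * inl A B (x n)‖) ω (𝓝 0)
  have key (t : A ⊗[ℂ] B) : Tendsto (fun n => ‖inl A B (x n) * ofAlgebraic A B t -
      ofAlgebraic A B t * inl A B (x n)‖) ω (𝓝 0) := by
    induction t with
    | zero => simp
    | add s t hs ht =>
      refine squeeze_zero (fun _ => norm_nonneg _) (fun n => ?_) (by simpa using hs.add ht)
      refine le_trans (le_of_eq ?_) (norm_add_le _ _)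
      rw [map_add]; congr 1; noncomm_ring
    | tmul a b =>
      refine squeeze_zero (fun _ => norm_nonneg _) (fun n => ?_)
        (by simpa using (he a).mul_const ‖b‖)
      rw [ofAlgebraic_tmul, inl_apply, tmul_mul_tmul, tmul_mul_tmul, one_mul, mul_one, ← sub_tmul]
      exact norm_tmul_le _ _
  intro d
  rw [Metric.tendsto_nhds]
  intro ε hε
  obtain ⟨t, ht⟩ := denseRange_ofAlgebraic.exists_dist_lt d
    (show 0 < ε / 2 / (2 * (‖x‖ + 1)) by positivity)
  rw [dist_eq_norm] at ht
  set s := ofAlgebraic A B t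
  filter_upwards [(key t).eventually_lt_const (half_pos hε)] with n hn
  rw [Real.dist_eq, sub_zero, abs_norm]
  have hxn : ‖inl A B (x n)‖ ≤ ‖x‖ + 1 :=
    (NonUnitalStarAlgHom.norm_apply_le (inl A B) (x n)).trans
      ((x.norm_coe_le_norm n).trans (by linarith))
  have e1 : inl A B (x n) * d - d * inl A B (x n) = (inl A B (x n) * s - s * inl A B (x n)) +
      (inl A B (x n) * (d - s) - (d - s) * inl A B (x n)) := by noncomm_ring
  rw [e1]
  calc _ ≤ ‖inl A B (x n) * s - s * inl A B (x n)‖ +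
        (‖inl A B (x n)‖ * ‖d - s‖ + ‖d - s‖ * ‖inl A B (x n)‖) :=
        (norm_add_le _ _).trans (by
          gcongr
          exact (norm_sub_le _ _).trans (add_le_add (norm_mul_le _ _) (norm_mul_le _ _)))
    _ < ε / 2 + ((‖x‖ + 1) * (ε / 2 / (2 * (‖x‖ + 1))) +
        (ε / 2 / (2 * (‖x‖ + 1))) * (‖x‖ + 1)) :=
        add_lt_add_of_lt_of_le hn (add_le_add (mul_le_mul hxn ht.le (by positivity)
          (by positivity)) (mul_le_mul ht.le hxn (by positivity) (by positivity)))
    _ = ε := by field_simp; norm_num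

theorem map_action_map_inl {G : Type*} [Group G] {ω : Ultrafilter ℕ} (α : G →* (A ≃⋆ₐ[ℂ] A))
    (β : G →* (B ≃⋆ₐ[ℂ] B)) (g : G) (e : Ultrapower ω A) :
    Ultrapower.map ω (action α β g).toStarAlgHom (Ultrapower.map ω (inl A B) e) =
      Ultrapower.map ω (inl A B) (Ultrapower.map ω (α g).toStarAlgHom e) := by
  rw [Ultrapower.map_map, Ultrapower.map_map]
  have : (action α β g).toStarAlgHom.comp (inl A B) = (inl A B).comp (α g).toStarAlgHom := by
    ext1 a
    change congr (α g) (β g) (tmul a 1) = tmul (α g a) 1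
    rw [congr_tmul, map_one]
  rw [this]

end MinTensor

/-! ### Consequences of a minimal projection -/

section MinimalProjection

variable {A : Type*} [CStarAlgebra A] {p : A}

/-- If `1` is close to an element Cuntz dominated by a minimal projection, then the algebra is
one-dimensional. -/
theorem IsMinimalProjection.nonempty_starAlgEquiv [Nontrivial A] (hp : IsMinimalProjection p)
    {v : A} (hv : ‖v * p * star v - 1‖ < 1) : Nonempty (A ≃⋆ₐ[ℂ] ℂ) := by
  obtain ⟨-, hpp, hcorner⟩ := hp
  have hp2 : p * p = p := hpp.isIdempotentElem
  have hu : IsUnit (v * p * star v) := by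
    rw [norm_sub_rev] at hv
    simpa using isUnit_one_sub_of_norm_lt_one hv
  -- With `u = v p v*`, the one-dimensional corner gives `u b u ∈ ℂ u`. Cancelling the invertible
  -- `u`, the case `b = 1` shows `u` to be scalar, and then every `b` is scalar.
  have key (b : A) : ∃ c : ℂ, v * p * star v * b * (v * p * star v) = c • (v * p * star v) := by
    obtain ⟨c, hc⟩ := hcorner (star v * b * v)
    refine ⟨c, ?_⟩
    calc _ = v * (p * (star v * b * v) * p) * star v := by noncomm_ring
      _ = _ := by rw [hc, mul_smul_comm, smul_mul_assoc]
  obtain ⟨μ, hμ⟩ := key 1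
  have hμ1 : v * p * star v = algebraMap ℂ A μ := by
    refine hu.mul_right_cancel ?_
    rw [mul_one] at hμ
    rw [hμ, Algebra.smul_def]
  have hμ0 : μ ≠ 0 := by
    rintro rfl
    rw [hμ1, map_zero] at hu
    exact not_isUnit_zero hu
  have hsurj : Function.Surjective (algebraMap ℂ A) := fun b => by
    obtain ⟨c, hc⟩ := key b
    refine ⟨c / μ, ?_⟩
    have h1 : v * p * star v * b = algebraMap ℂ A c := by
      refine hu.mul_right_cancel ?_
      rw [hc, Algebra.smul_def]
    rw [hμ1] at h1
    rw [div_eq_inv_mul, map_mul, ← h1, ← mul_assoc, ← map_mul, inv_mul_cancel₀ hμ0, map_one,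
      one_mul]
  exact ⟨(StarAlgEquiv.ofBijective (StarAlgHom.ofId ℂ A)
    ⟨(algebraMap ℂ A).injective, hsurj⟩).symm⟩

/-- Central sequences are asymptotically scalar in a simple algebra with a minimal projection. -/
theorem IsMinimalProjection.exists_tendsto_sub_smul_one (hA : IsSimpleCStar A)
    (hp : IsMinimalProjection p) {ω : Ultrafilter ℕ} {x : ℕ →ᵇ A}
    (hx : Ultrapower.mk ω A x ∈ centralSequences ω A) :
    ∃ c : ℕ → ℂ, Tendsto (fun n => ‖x n - c n • (1 : A)‖) ω (𝓝 0) := by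
  rw [Ultrapower.mk_mem_centralSequences_iff] at hx
  obtain ⟨ι, _, y, w, h1⟩ := hA.exists_sum_mul_mul_eq_one hp.1
  obtain ⟨-, hpp, hcorner⟩ := hp
  have hp2 : p * p = p := hpp.isIdempotentElem
  choose c hc using fun n => hcorner (x n)
  refine ⟨c, ?_⟩
  have hlim : Tendsto (fun n => ∑ i, ‖x n * (y i * p) - y i * p * x n‖ * ‖p * w i‖) ω (𝓝 0) := by
    simpa using tendsto_finsetSum Finset.univ fun i _ => (hx (y i * p)).mul_const ‖p * w i‖
  refine squeeze_zero (fun _ => norm_nonneg _) (fun n => ?_) hlim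
  -- Expand `1 = ∑ y i * p * w i`. Moving `x n` past `y i * p` costs a commutator that vanishes
  -- along `ω`, and `p * x n * p = c n • p` accounts for the scalar.
  have h2 : x n - c n • (1 : A) = ∑ i, (x n * (y i * p) - y i * p * x n) * (p * w i) := by
    conv_lhs => rw [← mul_one (x n), ← h1]
    rw [Finset.mul_sum, Finset.smul_sum, ← Finset.sum_sub_distrib]
    refine Finset.sum_congr rfl fun i _ => ?_
    have h3 : y i * p * x n * (p * w i) = c n • (y i * p * w i) := by
      calc _ = y i * (p * x n * p) * w i := by noncomm_ring
        _ = _ := by rw [hc, mul_smul_comm, smul_mul_assoc]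
    have h4 : x n * (y i * p) * (p * w i) = x n * (y i * p * w i) := by
      calc _ = x n * (y i * (p * p) * w i) := by noncomm_ring
        _ = _ := by rw [hp2]
    rw [sub_mul, h3, h4]
  rw [h2]
  exact norm_sum_le_of_le _ fun i _ => norm_mul_le _ _

/-- The class `e` is represented asymptotically by scalars `c n`, which unital homomorphisms fix.
The product is therefore asymptotically `c n ^ 2`, whose vanishing forces `e = 0`. -/
theorem IsMinimalProjection.eq_zero_of_map_mul_map_eq_zero (hA : IsSimpleCStar A)
    (hp : IsMinimalProjection p) {ω : Ultrafilter ℕ} {e : Ultrapower ω A}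
    (he : e ∈ centralSequences ω A) (φ ψ : A →⋆ₐ[ℂ] A)
    (h : Ultrapower.map ω φ e * Ultrapower.map ω ψ e = 0) : e = 0 := by
  have := hA.1
  obtain ⟨x, rfl⟩ := Ideal.Quotient.mk_surjective e
  obtain ⟨c, hc⟩ := hp.exists_tendsto_sub_smul_one hA he
  have h0 : Tendsto (fun n => ‖φ (x n) * ψ (x n)‖) ω (𝓝 0) :=
    Ideal.Quotient.eq_zero_iff_mem.mp
      (show Ultrapower.mk ω A (seqMap φ x * seqMap ψ x) = 0 by rw [map_mul]; exact h)
  have hn (φ : A →⋆ₐ[ℂ] A) (n : ℕ) : ‖φ (x n)‖ ≤ ‖x‖ :=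
    (NonUnitalStarAlgHom.norm_apply_le φ (x n)).trans (x.norm_coe_le_norm n)
  have hs (φ : A →⋆ₐ[ℂ] A) (n : ℕ) : ‖φ (x n) - c n • (1 : A)‖ ≤ ‖x n - c n • (1 : A)‖ := by
    have := NonUnitalStarAlgHom.norm_apply_le φ (x n - c n • (1 : A))
    rwa [map_sub, map_smul, map_one] at this
  have hsq : Tendsto (fun n => ‖c n‖ ^ 2) ω (𝓝 0) := by
    refine squeeze_zero (fun _ => by positivity) (fun n => ?_)
      (show Tendsto (fun n => ‖φ (x n) * ψ (x n)‖ + ‖x n - c n • (1 : A)‖ * ‖x‖ +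
        ‖x‖ * ‖x n - c n • (1 : A)‖ + ‖x n - c n • (1 : A)‖ * ‖x n - c n • (1 : A)‖) ω (𝓝 0) by
        simpa using ((h0.add (hc.mul_const ‖x‖)).add (hc.const_mul ‖x‖)).add (hc.mul hc))
    have e1 : (c n * c n) • (1 : A) = φ (x n) * ψ (x n) - (φ (x n) - c n • (1 : A)) * ψ (x n) -
        φ (x n) * (ψ (x n) - c n • (1 : A)) +
        (φ (x n) - c n • (1 : A)) * (ψ (x n) - c n • (1 : A)) := by
      simp only [sub_mul, mul_sub, smul_mul_assoc, mul_smul_comm, one_mul, mul_one, mul_smul,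
        smul_sub]
      abel
    calc ‖c n‖ ^ 2 = ‖(c n * c n) • (1 : A)‖ := by rw [norm_smul, norm_one, norm_mul]; ring
      _ ≤ ‖φ (x n) * ψ (x n)‖ + ‖(φ (x n) - c n • (1 : A)) * ψ (x n)‖ +
        ‖φ (x n) * (ψ (x n) - c n • (1 : A))‖ +
        ‖(φ (x n) - c n • (1 : A)) * (ψ (x n) - c n • (1 : A))‖ := by
        rw [e1]
        exact (norm_add_le _ _).trans (by
          gcongr; exact (norm_sub_le _ _).trans (by gcongr; exact norm_sub_le _ _))
      _ ≤ _ := by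
        gcongr
        · exact (norm_mul_le _ _).trans (mul_le_mul (hs φ n) (hn ψ n) (by positivity)
            (by positivity))
        · exact (norm_mul_le _ _).trans (mul_le_mul (hn φ n) (hs ψ n) (by positivity)
            (by positivity))
        · exact (norm_mul_le _ _).trans (mul_le_mul (hs φ n) (hs ψ n) (by positivity)
            (by positivity))
  have hc0 : Tendsto (fun n => ‖c n‖) ω (𝓝 0) := by
    simpa [Real.sqrt_sq] using hsq.sqrt
  refine Ideal.Quotient.eq_zero_iff_mem.mpr ?_
  refine squeeze_zero (fun _ => norm_nonneg _) (fun n => ?_) (by simpa using hc.add hc0)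
  calc ‖x n‖ = ‖(x n - c n • (1 : A)) + c n • (1 : A)‖ := by rw [sub_add_cancel]
    _ ≤ ‖x n - c n • (1 : A)‖ + ‖c n • (1 : A)‖ := norm_add_le _ _
    _ = _ := by rw [norm_smul, norm_one, mul_one]

end MinimalProjection

/-! ### Rokhlin towers and the exclusion of minimal projections -/

section Towers

variable {G : Type*} [Group G] {ω : Ultrafilter ℕ}

/-- The invariance makes `T ∩ gT` nonempty, so `T` contains some `t` together with `g t ≠ t`. -/
theorem IsInvariantSet.exists_ne {T : Finset G} {g : G} (hg : g ≠ 1)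
    (hT : IsInvariantSet {g} (1 / 2) T) : ∃ s ∈ T, ∃ t ∈ T, s ≠ t := by
  obtain ⟨hne, h⟩ := hT
  have hpos : (0 : ℝ) < T.card := by exact_mod_cast hne.card_pos
  have h1 : ((T : Set G) ∩ ⋂ k ∈ ({g} : Finset G), k • (T : Set G)).ncard ≠ 0 := fun h0 => by
    rw [h0] at h
    norm_num at h
    linarith
  obtain ⟨s, hs, hs'⟩ := Set.nonempty_of_ncard_ne_zero h1
  simp only [Finset.mem_singleton, Set.iInter_iInter_eq_left] at hs'
  obtain ⟨t, ht, rfl⟩ := hs'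
  exact ⟨g • t, hs, t, ht, fun h => hg (by simpa using h)⟩

theorem isInvariantSet_singleton_one [Subsingleton G] (K : Finset G) {ε : ℝ} (hε : 0 < ε) :
    IsInvariantSet K ε {1} := by
  refine ⟨Finset.singleton_nonempty 1, ?_⟩
  have : ((({1} : Finset G) : Set G) ∩ ⋂ g ∈ K, g • ((({1} : Finset G)) : Set G)) = {1} := by
    ext g
    simp [Subsingleton.elim _ (1 : G)]
  rw [this]
  simp [hε.le]

variable {A : Type*} [CStarAlgebra A]

/-- Test the property on `z = p` with sets having at least two elements. Orthogonality of two levels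
of a tower makes each `e i` zero, so the remainder is `1`; its domination by `p` would make the
algebra one-dimensional. -/
theorem HasRokhlinTowers.not_isMinimalProjection [Nontrivial G] {P : Ultrapower ω A → Prop}
    {α : G →* (A ≃⋆ₐ[ℂ] A)} (h : HasRokhlinTowers ω P α) (hA : IsSimpleCStar A)
    (hA' : IsEmpty (A ≃⋆ₐ[ℂ] ℂ)) (p : A) : ¬ IsMinimalProjection p := by
  intro hp
  have := hA.1
  obtain ⟨g, hg⟩ := exists_ne (1 : G)
  have hpos : IsPos p := ⟨p, by rw [hp.2.1.isSelfAdjoint.star_eq, hp.2.1.isIdempotentElem]⟩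
  obtain ⟨n, T, e, -, hT, he, hort, x, hx, hxp⟩ := h {g} (1 / 2) one_half_pos p hpos hp.1
  have he0 (i) : e i = 0 := by
    obtain ⟨s, hs, t, ht, hst⟩ := (hT i).exists_ne hg
    exact hp.eq_zero_of_map_mul_map_eq_zero hA (he i).1 _ _ (hort i i s hs t ht (Or.inl hst))
  simp only [he0, map_zero, Finset.sum_const_zero, sub_zero] at hx
  rw [← map_one (Ultrapower.mk ω A), Ultrapower.mk_eq_mk_iff] at hx
  obtain ⟨k, hk⟩ := (hx.eventually_lt_const (one_half_pos (α := ℝ))).exists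
  obtain ⟨v, hv⟩ := (hxp k).2.exists_norm_sub_lt (one_half_pos (α := ℝ))
  refine hA'.elim' (hp.nonempty_starAlgEquiv (v := v) ?_).some
  calc ‖v * p * star v - 1‖ = ‖(v * p * star v - x k) + (x k - 1)‖ := by
        rw [sub_add_sub_cancel]
    _ ≤ ‖v * p * star v - x k‖ + ‖x k - 1‖ := norm_add_le _ _
    _ < 1 / 2 + 1 / 2 := add_lt_add hv hk
    _ = 1 := by norm_num

/-- For the trivial group the single tower `{1}` with `e = 1` has remainder zero. This case is
separate because minimal projections cannot be excluded in it. -/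
theorem hasRokhlinTowers_of_subsingleton [Subsingleton G] {P : Ultrapower ω A → Prop} (h1 : P 1)
    (α : G →* (A ≃⋆ₐ[ℂ] A)) : HasRokhlinTowers ω P α := by
  intro K ε hε z _ _
  refine ⟨1, fun _ => {1}, fun _ => 1, one_pos, fun _ => isInvariantSet_singleton_one K hε,
    fun _ => ⟨one_mem _, h1⟩, fun i j g _ h _ hne => ?_, 0, ?_,
    fun n => ⟨⟨0, by simp⟩, fun _ => 0, by simp⟩⟩
  · exact absurd (Subsingleton.elim i j) (hne.resolve_left (not_not.mpr (Subsingleton.elim g h)))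
  · simp

end Towers

/-! ### Transfer of towers to the tensor product -/

theorem HasRokhlinTowers.minTensor {G : Type*} [Group G] {ω : Ultrafilter ℕ} {A : Type u}
    {B : Type v} [CStarAlgebra A] [CStarAlgebra B] (hA : IsSimpleCStar A)
    (hA' : IsEmpty (A ≃⋆ₐ[ℂ] ℂ)) (hB : IsSimpleCStar B) {α : G →* (A ≃⋆ₐ[ℂ] A)}
    (β : G →* (B ≃⋆ₐ[ℂ] B)) {P : Ultrapower ω A → Prop} {Q : Ultrapower ω (MinTensor A B) → Prop}
    (hPQ : ∀ e, P e → Q (Ultrapower.map ω (MinTensor.inl A B) e)) (hQ : Q 1)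
    (h : HasRokhlinTowers ω P α) : HasRokhlinTowers ω Q (MinTensor.action α β) := by
  rcases subsingleton_or_nontrivial G with hG | hG
  · exact hasRokhlinTowers_of_subsingleton hQ _
  have hmin := h.not_isMinimalProjection hA hA'
  let _ := CStarAlgebra.spectralOrder A
  have := CStarAlgebra.spectralOrderedRing A
  let _ := CStarAlgebra.spectralOrder B
  have := CStarAlgebra.spectralOrderedRing B
  let _ := CStarAlgebra.spectralOrder (MinTensor A B)
  have := CStarAlgebra.spectralOrderedRing (MinTensor A B)
  intro K ε hε z hz hz0
  -- The given `z` is replaced by `a` from `A` before towers are chosen. The remainder is then below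
  -- `a ⊗ 1 ≤ v z v*`, hence below `z`.
  obtain ⟨a, v, ha, ha0, hav⟩ :=
    MinTensor.exists_inl_le_conj hA hmin hB (isPos_iff_nonneg.mp hz) hz0
  obtain ⟨n, T, e, hn, hT, he, hort, hle⟩ := h K ε hε a (isPos_iff_nonneg.mpr ha) ha0
  refine ⟨n, T, fun i => Ultrapower.map ω (MinTensor.inl A B) (e i), hn, hT, fun i =>
    ⟨MinTensor.map_inl_mem_centralSequences (he i).1, hPQ _ (he i).2⟩, ?_, ?_⟩
  · intro i j g hg h hh hne
    rw [MinTensor.map_action_map_inl, MinTensor.map_action_map_inl, ← map_mul,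
      hort i j g hg h hh hne, map_zero]
  · simp only [MinTensor.map_action_map_inl]
    have h1 := hle.map (MinTensor.inl A B)
    simp only [map_sub, map_one, map_sum] at h1
    refine h1.trans ((CuntzLE.of_le ?_ hav).trans (.conj v z))
    exact MinTensor.tmul_nonneg ha zero_le_one

theorem mainTheorem11
    {G : Type*} [Group G] [Countable G] (hG : IsAmenableGroup G)
    (ω : Ultrafilter ℕ) (hω : ∀ n : ℕ, ω ≠ pure n)
    {A : Type u} {B : Type v} [CStarAlgebra A] [CStarAlgebra B]
    (hA : IsSimpleCStar A) (hA' : IsEmpty (A ≃⋆ₐ[ℂ] ℂ)) (hB : IsSimpleCStar B)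
    (α : G →* (A ≃⋆ₐ[ℂ] A)) (β : G →* (B ≃⋆ₐ[ℂ] B)) :
    (WeakTracialRokhlin ω α → WeakTracialRokhlin ω (MinTensor.action α β)) ∧
      (TracialRokhlin ω α → TracialRokhlin ω (MinTensor.action α β)) := by
  refine ⟨HasRokhlinTowers.minTensor hA hA' hB β (fun e he => ?_) ?_,
    HasRokhlinTowers.minTensor hA hA' hB β (fun e he => he.map_ultrapower _) (.one _)⟩
  · exact ⟨he.1.map_ultrapower _, (Ultrapower.norm_map_le _ e).trans he.2⟩
  · have := hA.1
    refine ⟨⟨1, by simp⟩, (Ultrapower.norm_mk_le 1).trans ?_⟩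
    refine (BoundedContinuousFunction.norm_le zero_le_one).mpr fun n => ?_
    -- The bound `‖1‖ ≤ 1` in the tensor product comes from contractivity of the unital embedding of
    -- the nonzero algebra `A`.
    have h := NonUnitalStarAlgHom.norm_apply_le (MinTensor.inl A B) (1 : A)
    rwa [map_one, norm_one (α := A)] at h
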